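/- **Theorem 3.1.** Let $\mathbb K$ be a field. Consider $\mathbb N$-graded associative unital $\mathbb K$-algebras $\mathcal A=\bigoplus_{n\ge 0}\mathcal A_n$ which are connected ($\mathcal A_0=\mathbb K 1\neq 0$), generated by the finite-dimensional space $E=\mathcal A_1$, and finitely presented with homogeneous relations of degrees $\ge 2$, i.e. the kernel of $T(E)\to\mathcal A$ is the two-sided ideal generated by finitely many homogeneous elements of degrees $\ge 2$. Such an algebra is called *regular of global dimension $D$* if its global dimension is $D<\infty$ and it is Gorenstein: $\mathrm{Ext}^n_{\mathcal A}(\mathbb K,\mathcal A)=0$ for $n\ne D$, and $\mathrm{Ext}^D_{\mathcal A}(\mathbb K,\mathcal A)\cong\mathbb K$ as right $\mathcal A$-modules. Here modules are left modules unless said otherwise, and $\mathbb K$ is the trivial module $\mathcal A/\bigoplus_{n\geq 1}\mathcal A_n$ (no growth condition is imposed). Let $N\ge 2$, let $V$ be a $\mathbb K$-vector space and let $w$ be an $(N+1)$-linear form on $V$. The form $w$ is *preregular* if (i) $w(X,X_1,\dots,X_N)=0$ for all $X_1,\dots,X_N\in V$ implies $X=0$; (ii) there is $Q\in GL(V)$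 with $w(X_0,\dots,X_N)=w(QX_N,X_0,\dots,X_{N-1})$ for all $X_0,\dots,X_N\in V$. It is *3-regular* if it is preregular and (iii) whenever endomorphisms $L_0,L_1$ of $V$ satisfy $w(L_0X_0,X_1,X_2,\dots,X_N)=w(X_0,L_1X_1,X_2,\dots,X_N)$ for all $X_0,\dots,X_N\in V$, one has $L_0=L_1=k\,\mathrm{Id}_V$ for some $k\in\mathbb K$. For an $(N+1)$-linear form $w$ on $\mathbb K^g$ with components $W_{\lambda_0\dots\lambda_N}=w(e_{\lambda_0},\dots,e_{\lambda_N})$ in the canonical basis, let $\mathcal A(w,N)$ be the graded algebra generated by $x^1,\dots,x^g$ in degree $1$ with the relations $$\sum_{\lambda_1,\dots,\lambda_N}W_{\lambda\lambda_1\dots\lambda_N}\,x^{\lambda_1}\cdots x^{\lambda_N}=0,\qquad \lambda=1,\dots,g .$$ Then every regular algebra $\mathcal A$ of global dimension $3$ is isomorphic, as a graded algebra, to $\mathcal A(w,N)$ for some $N\ge 2$, some $g\ge 2$ and some 3-regular $(N+1)$-linear form $w$ on $\mathbb K^g$. -/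

import Mathlib

open CategoryTheory

universe u v

noncomputable section

/-! ### Multilinear forms -/

section Forms

variable {K : Type v} [Field K] {V : Type u} [AddCommGroup V] [Module K V]

/-- An `(n + 1)`-linear form `w` on `V` is `Q`-cyclic, for `Q` in `GL(V)`, if
`w (X_0, …, X_n) = w (Q X_n, X_0, …, X_{n-1})` for all `X_0, …, X_n`. -/
def IsQCyclic {n : ℕ} (w : MultilinearMap K (fun _ : Fin (n + 1) => V) K) (Q : V ≃ₗ[K] V) : Prop :=
  ∀ X : Fin (n + 1) → V,
    w X = w (Fin.cons (Q (X (Fin.last n))) (fun i : Fin n => X i.castSucc))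

/-- A preregular form: nondegenerate in the first argument and `Q`-cyclic for some `Q`. -/
structure IsPreregular {n : ℕ} (w : MultilinearMap K (fun _ : Fin (n + 1) => V) K) : Prop where
  nondegenerate : ∀ X : V, (∀ Y : Fin n → V, w (Fin.cons X Y) = 0) → X = 0
  cyclic : ∃ Q : V ≃ₗ[K] V, IsQCyclic w Q

/-- A `3`-regular `(N + 1)`-linear form (meant for `N ≥ 2`): it is preregular, and
`w (L₀ X_0, X_1, X_2, …, X_N) = w (X_0, L₁ X_1, X_2, …, X_N)` for all `X_0, …, X_N` is only possible
for endomorphisms `L₀ = L₁ = k • 1` with a scalar `k`. -/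
structure IsThreeRegular {N : ℕ} (w : MultilinearMap K (fun _ : Fin (N + 1) => V) K) : Prop where
  preregular : IsPreregular w
  two_site : ∀ L₀ L₁ : Module.End K V,
    (∀ X : Fin (N + 1) → V,
      w (Function.update X 0 (L₀ (X 0))) = w (Function.update X 1 (L₁ (X 1)))) →
    ∃ k : K, L₀ = k • (1 : Module.End K V) ∧ L₁ = k • (1 : Module.End K V)

end Forms

/-! ### The algebra `A(w, N)` -/

section FormAlgebra

variable {K : Type v} [Field K] {g N : ℕ}

/-- The element `∑ W_{l l_1 … l_N} x^{l_1} ⋯ x^{l_N}` of the free algebra on `x^1, …, x^g`, where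
`W_{l_0 … l_N} = w (e_{l_0}, …, e_{l_N})` in the canonical basis of `K^g`. -/
def formRelator (w : MultilinearMap K (fun _ : Fin (N + 1) => Fin g → K) K) (l : Fin g) :
    FreeAlgebra K (Fin g) :=
  ∑ f : Fin N → Fin g,
    w (Fin.cons (Pi.single l 1) (fun i : Fin N => Pi.single (f i) 1)) •
      (List.ofFn fun i : Fin N => FreeAlgebra.ι K (f i)).prod

/-- The defining relations of `A(w, N)`. -/
inductive FormRel (w : MultilinearMap K (fun _ : Fin (N + 1) => Fin g → K) K) :
    FreeAlgebra K (Fin g) → FreeAlgebra K (Fin g) → Prop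
  | relator (l : Fin g) : FormRel w (formRelator w l) 0

/-- The algebra `A(w, N)`: generators `x^1, …, x^g`, relations
`∑ W_{l l_1 … l_N} x^{l_1} ⋯ x^{l_N} = 0` for `l = 1, …, g`. -/
abbrev FormAlgebra (w : MultilinearMap K (fun _ : Fin (N + 1) => Fin g → K) K) : Type v :=
  RingQuot (FormRel w)

/-- The generator `x^l` of `A(w, N)`. -/
def FormAlgebra.x (w : MultilinearMap K (fun _ : Fin (N + 1) => Fin g → K) K) (l : Fin g) :
    FormAlgebra w :=
  RingQuot.mkAlgHom K (FormRel w) (FreeAlgebra.ι K l)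

/-- The homogeneous component of degree `n` of `A(w, N)`: the span of the products of `n`
generators. -/
def FormAlgebra.component (w : MultilinearMap K (fun _ : Fin (N + 1) => Fin g → K) K) (n : ℕ) :
    Submodule K (FormAlgebra w) :=
  Submodule.span K (Set.range (FormAlgebra.x w)) ^ n

end FormAlgebra

/-! ### Graded algebras and regularity -/

section Graded

variable {K : Type v} [Field K] {A : Type u} [Ring A] [Algebra K A]

/-- The canonical homomorphism `T(A_1) → A` from the tensor algebra on the component of
degree `1`. -/
def degreeOneLift (𝒜 : ℕ → Submodule K A) : TensorAlgebra K (𝒜 1) →ₐ[K] A :=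
  TensorAlgebra.lift K (𝒜 1).subtype

/-- The graded algebras under consideration: connected (`A_0 = K 1`, which is one-dimensional),
generated by the finite-dimensional component `E = A_1`, and finitely presented as `T(E) / [R]`
with homogeneous relations of degrees at least `2`. -/
structure IsGrAlg (𝒜 : ℕ → Submodule K A) [GradedAlgebra 𝒜] : Prop where
  nontrivial : Nontrivial A
  connected : 𝒜 0 = Submodule.span K {(1 : A)}
  finite_degree_one : Module.Finite K (𝒜 1)
  generated : Function.Surjective (degreeOneLift 𝒜)
  presented : ∃ R : Finset (TensorAlgebra K (𝒜 1)),
    (∀ f ∈ R, ∃ n : ℕ, 2 ≤ n ∧ f ∈ LinearMap.range (TensorAlgebra.ι K (M := 𝒜 1)) ^ n) ∧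
      TwoSidedIdeal.ker (degreeOneLift 𝒜) =
        TwoSidedIdeal.span (R : Set (TensorAlgebra K (𝒜 1)))

/-- The trivial left module `K = A_0` of a connected graded algebra: the quotient of `A` by the
kernel `⊕_{n ≥ 1} A_n` of the projection onto the component of degree `0`. -/
def trivialModule (𝒜 : ℕ → Submodule K A) [GradedAlgebra 𝒜] : ModuleCat.{u} A :=
  ModuleCat.of A (A ⧸ RingHom.ker (GradedRing.projZeroRingHom 𝒜))

/-- The (left) global dimension of a ring: the supremum of the projective dimensions of its left
modules. For the graded algebras considered here it agrees with the right one. -/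
def globalDimension (A : Type u) [Ring A] : WithBot ℕ∞ :=
  ⨆ M : ModuleCat.{u} A, projectiveDimension M

/-- The right action of `a : A` on `Ext^n_A(M, A)`, induced by the endomorphism `b ↦ b * a` of the
left module `A`. -/
def extRightMul {M : ModuleCat.{u} A} {n : ℕ} (e : Abelian.Ext M (ModuleCat.of A A) n) (a : A) :
    Abelian.Ext M (ModuleCat.of A A) n :=
  e.comp (Abelian.Ext.mk₀ (ModuleCat.ofHom (LinearMap.toSpanSingleton A A a))) (add_zero n)

/-- The Gorenstein property in dimension `D`: `Ext^n_A(K, A) = 0` for `n ≠ D`, and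
`Ext^D_A(K, A)` is the trivial right module `K = A_0`, on which `A` acts through its projection
onto `A_0`. -/
structure IsGorenstein (𝒜 : ℕ → Submodule K A) [GradedAlgebra 𝒜] (D : ℕ) : Prop where
  ext_eq_zero : ∀ n : ℕ, n ≠ D →
    Subsingleton (Abelian.Ext (trivialModule 𝒜) (ModuleCat.of A A) n)
  ext_top : ∃ φ : Abelian.Ext (trivialModule 𝒜) (ModuleCat.of A A) D ≃+ 𝒜 0,
    ∀ (e : Abelian.Ext (trivialModule 𝒜) (ModuleCat.of A A) D) (a : A),
      φ (extRightMul e a) = φ e * GradedRing.projZeroRingHom' 𝒜 a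

/-- A regular algebra of global dimension `D` (no growth condition is imposed). -/
structure IsRegularAlgebra (𝒜 : ℕ → Submodule K A) [GradedAlgebra 𝒜] (D : ℕ) : Prop where
  grAlg : IsGrAlg 𝒜
  globalDimension_eq : globalDimension A = (D : WithBot ℕ∞)
  gorenstein : IsGorenstein 𝒜 D

end Graded

end

/-! Write `I` for the augmentation ideal and `y` for a basis of `A_1`. Minimal homogeneous relations
give an exact sequence `A^r → A^g → A → K → 0` of left modules, whose first map is a matrix `m` with
rows of homogeneous entries (`IsGrAlg.exists_minimal_relations`). Since the global dimension is `3`,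
the kernel of `m` is projective; since `Ext^3(K, A)` is one-dimensional, graded Nakayama makes this
kernel free on one homogeneous vector `z` (`IsRegularAlgebra.exists_top_generator`).

Now dualize into `A`. The Gorenstein condition says that the dual complex is a resolution of the
trivial right module, so the entries of `z` generate `I` as a right ideal
(`IsRegularAlgebra.exists_right_combination`), and minimally so
(`IsRegularAlgebra.eq_zero_of_combination`). Hence they form a basis of `A_1`: there are as many
relations as generators, and all relations have the same degree `p + 1`. After a change of basis `z`
becomes `y`, and one square matrix `m` with entries of degree `p` satisfies both `m y = 0` and `y m
= 0` (`IsRegularAlgebra.exists_relation_matrix`).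

Let `w` have coefficients `W_{i μ j}`, where `m i j` is the sum over words `μ` of `W_{i μ j} y^μ`;
so `N = p + 1`. The equations `y m = 0` are relations of the lowest degree, hence combinations of
the equations `m y = 0`. This is the cyclicity of `w` up to a matrix, which is invertible because
`Ext^1(K, A) = 0`. The same vanishing turns the two-site condition into the statement that a linear
substitution of the generators is multiplication by a scalar (`IsRelationMatrix.isThreeRegular`).
Finally the rows of `m` generate all relations, so induction on the degree identifies `A` with `A(w,
N)` (`IsRelationMatrix.toAlgebra_bijective`). -/

noncomputable section

/-! ### Dimension shifting for `Ext` into the ring. -/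

section ExtShift

open Abelian

variable {A : Type u} [Ring A] {P M : Type u} [AddCommGroup P] [Module A P] [AddCommGroup M]
  [Module A M]

lemma ext_eq_zero_of_moduleProjective [Module.Projective A P] {n : ℕ}
    (e : Ext (ModuleCat.of A P) (ModuleCat.of A A) (n + 1)) : e = 0 :=
  Ext.eq_zero_of_projective e

/-- If `Ext^1(M, A) = 0`, then linear forms on the kernel of a surjection `P → M` extend to `P`. -/
lemma exists_extension_of_ext_one {f : P →ₗ[A] M} (hf : Function.Surjective f)
    [Subsingleton (Ext (ModuleCat.of A M) (ModuleCat.of A A) 1)]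
    (h : LinearMap.ker f →ₗ[A] A) :
    ∃ h' : P →ₗ[A] A, ∀ x : LinearMap.ker f, h' x = h x := by
  obtain ⟨e, he⟩ := Ext.contravariant_sequence_exact₁ (LinearMap.shortExact_shortComplexKer hf)
    (ModuleCat.of A A) (Ext.mk₀ (ModuleCat.ofHom h)) (n₁ := 1) rfl (Subsingleton.elim _ _)
  obtain ⟨h', rfl⟩ := Ext.homEquiv₀.symm.surjective e
  refine ⟨h'.hom, fun x => ?_⟩
  rw [Ext.homEquiv₀_symm_apply, Ext.mk₀_comp_mk₀] at he
  have := (Ext.mk₀_bijective _ _).1 he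
  exact congrArg (fun t => t.hom x) this

/-- Long exact sequence of `0 → ker f → P → M → 0`: the terms `Ext(P, A)` on both sides vanish in
positive degree. -/
lemma extClass_comp_bijective [Module.Projective A P] {f : P →ₗ[A] M}
    (hf : Function.Surjective f) (n : ℕ) :
    Function.Bijective (fun e : Ext (ModuleCat.of A (LinearMap.ker f)) (ModuleCat.of A A) (n + 1) =>
      (LinearMap.shortExact_shortComplexKer hf).extClass.comp e
        (show 1 + (n + 1) = n + 2 by omega)) := by
  constructor
  · intro e₁ e₂ h
    rw [← sub_eq_zero]
    obtain ⟨e, he⟩ := Ext.contravariant_sequence_exact₁ (LinearMap.shortExact_shortComplexKer hf)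
      (ModuleCat.of A A) (e₁ - e₂) (n₁ := n + 2) (by omega) (by
        rw [sub_eq_add_neg, Ext.comp_add, Ext.comp_neg, ← sub_eq_add_neg, sub_eq_zero]
        exact h)
    rw [← he, ext_eq_zero_of_moduleProjective e, Ext.comp_zero]
  · intro e
    exact Ext.contravariant_sequence_exact₃ (LinearMap.shortExact_shortComplexKer hf)
      (ModuleCat.of A A) e (ext_eq_zero_of_moduleProjective _) (by omega)

lemma subsingleton_ext_ker [Module.Projective A P] {f : P →ₗ[A] M}
    (hf : Function.Surjective f) {n : ℕ}
    (h : Subsingleton (Ext (ModuleCat.of A M) (ModuleCat.of A A) (n + 2))) :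
    Subsingleton (Ext (ModuleCat.of A (LinearMap.ker f)) (ModuleCat.of A A) (n + 1)) :=
  ⟨fun _ _ => (extClass_comp_bijective hf n).1 (Subsingleton.elim _ _)⟩

/-- The connecting map is composition on one side with the extension class, while the right action
of `A` is composition on the other side; associativity makes the shift equivariant. -/
lemma exists_addEquiv_ext_ker [Module.Projective A P] {f : P →ₗ[A] M}
    (hf : Function.Surjective f) {n : ℕ} {B : Type*} [AddCommGroup B] (act : A → B → B)
    (φ : Ext (ModuleCat.of A M) (ModuleCat.of A A) (n + 2) ≃+ B)
    (hφ : ∀ e a, φ (extRightMul e a) = act a (φ e)) :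
    ∃ ψ : Ext (ModuleCat.of A (LinearMap.ker f)) (ModuleCat.of A A) (n + 1) ≃+ B,
      ∀ e a, ψ (extRightMul e a) = act a (ψ e) := by
  refine ⟨(AddEquiv.ofBijective ((LinearMap.shortExact_shortComplexKer hf).extClass.precomp
    (ModuleCat.of A A) (show 1 + (n + 1) = n + 2 by omega))
    (extClass_comp_bijective hf n)).trans φ, fun e a => ?_⟩
  simp only [AddEquiv.trans_apply]
  rw [← hφ]
  congr 1
  simp only [extRightMul]
  exact (Ext.comp_assoc_of_third_deg_zero _ _ _ (show 1 + (n + 1) = n + 2 by omega)).symm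

/-- The last step of the shift, from `Ext^1` to `Hom`, is no longer bijective: the connecting map is
onto since `Ext^1(P, A) = 0`, and it kills precisely the forms that extend to `P`. -/
lemma exists_addHom_dual_ker [Module.Projective A P] {f : P →ₗ[A] M}
    (hf : Function.Surjective f) {B : Type*} [AddCommGroup B] (act : A → B → B)
    (φ : Ext (ModuleCat.of A M) (ModuleCat.of A A) 1 ≃+ B)
    (hφ : ∀ e a, φ (extRightMul e a) = act a (φ e)) :
    ∃ θ : (LinearMap.ker f →ₗ[A] A) →+ B, Function.Surjective θ ∧
      (∀ h a, θ (LinearMap.toSpanSingleton A A a ∘ₗ h) = act a (θ h)) ∧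
      ∀ h, θ h = 0 → ∃ h' : P →ₗ[A] A, ∀ x : LinearMap.ker f, h' x = h x := by
  let S := (LinearMap.shortExact_shortComplexKer hf)
  let δ : (LinearMap.ker f →ₗ[A] A) →+ Ext (ModuleCat.of A M) (ModuleCat.of A A) 1 :=
    { toFun := fun h => S.extClass.comp (Ext.mk₀ (ModuleCat.ofHom h)) rfl
      map_zero' := by
        rw [ModuleCat.ofHom_zero, Ext.mk₀_zero, Ext.comp_zero]
      map_add' := fun h₁ h₂ => by
        rw [ModuleCat.ofHom_add, Ext.mk₀_add, Ext.comp_add] }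
  refine ⟨φ.toAddMonoidHom.comp δ, ?_, fun h a => ?_, fun h hh => ?_⟩
  · refine φ.surjective.comp fun e => ?_
    obtain ⟨e', he'⟩ := Ext.contravariant_sequence_exact₃ S
      (ModuleCat.of A A) e (ext_eq_zero_of_moduleProjective _) (n₀ := 0) rfl
    obtain ⟨h', rfl⟩ := Ext.homEquiv₀.symm.surjective e'
    exact ⟨h'.hom, he'⟩
  · change φ _ = act a (φ _)
    rw [← hφ]
    congr 1
    change S.extClass.comp (Ext.mk₀ _) rfl = (S.extClass.comp (Ext.mk₀ _) rfl).comp (Ext.mk₀ _) _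
    rw [ModuleCat.ofHom_comp, ← Ext.mk₀_comp_mk₀, Ext.comp_assoc_of_third_deg_zero]
  · have hz : δ h = 0 := φ.injective (by simpa using hh)
    obtain ⟨e, he⟩ := Ext.contravariant_sequence_exact₁ S
      (ModuleCat.of A A) (Ext.mk₀ (ModuleCat.ofHom h)) (n₁ := 1) rfl hz
    obtain ⟨h', rfl⟩ := Ext.homEquiv₀.symm.surjective e
    refine ⟨h'.hom, fun x => ?_⟩
    rw [Ext.homEquiv₀_symm_apply, Ext.mk₀_comp_mk₀] at he
    have := (Ext.mk₀_bijective _ _).1 he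
    exact congrArg (fun t => t.hom x) this

lemma hasProjectiveDimensionLT_ker [Module.Projective A P] {f : P →ₗ[A] M}
    (hf : Function.Surjective f) {n : ℕ}
    (h : HasProjectiveDimensionLT (ModuleCat.of A M) (n + 2)) :
    HasProjectiveDimensionLT (ModuleCat.of A (LinearMap.ker f)) (n + 1) :=
  ((LinearMap.shortExact_shortComplexKer hf).hasProjectiveDimensionLT_X₃_iff n
    (inferInstanceAs (Projective (ModuleCat.of A P)))).1 h

/-- A linear map factors through a surjection whose kernel it kills. -/
lemma exists_factor_of_ker_le {N : Type*} [AddCommGroup N] [Module A N] {f : P →ₗ[A] M}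
    (hf : Function.Surjective f) (h : P →ₗ[A] N) (hk : LinearMap.ker f ≤ LinearMap.ker h) :
    ∃ k : M →ₗ[A] N, ∀ x, k (f x) = h x := by
  refine ⟨(LinearMap.ker f).liftQ h hk ∘ₗ (f.quotKerEquivOfSurjective hf).symm.toLinearMap,
    fun x => ?_⟩
  have : (f.quotKerEquivOfSurjective hf).symm (f x) = Submodule.Quotient.mk x := by
    rw [LinearEquiv.symm_apply_eq]; rfl
  simp [this]

end ExtShift

/-! ### Homogeneous components indexed by integers, so that degree shifts may be negative. -/

section GradedParts

variable {K : Type v} [Field K] {A : Type u} [Ring A] [Algebra K A]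

/-- The component of degree `k` of an `ℕ`-graded algebra, for an integer `k`. -/
def intPart (𝒜 : ℕ → Submodule K A) (k : ℤ) : Submodule K A :=
  if 0 ≤ k then 𝒜 k.toNat else ⊥

lemma intPart_natCast (𝒜 : ℕ → Submodule K A) (n : ℕ) : intPart 𝒜 n = 𝒜 n := by
  simp [intPart]

lemma intPart_of_neg (𝒜 : ℕ → Submodule K A) {k : ℤ} (hk : k < 0) : intPart 𝒜 k = ⊥ := by
  simp [intPart, hk]

variable (𝒜 : ℕ → Submodule K A) [GradedAlgebra 𝒜]

/-- The projection onto the component of degree `k`, for an integer `k`. -/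
def intProj (k : ℤ) : A →ₗ[K] A :=
  if 0 ≤ k then GradedAlgebra.proj 𝒜 k.toNat else 0

lemma intProj_natCast (n : ℕ) (a : A) :
    intProj 𝒜 n a = (DirectSum.decompose 𝒜 a n : A) := by
  simp [intProj, GradedAlgebra.proj_apply]

lemma intProj_of_neg {k : ℤ} (hk : k < 0) (a : A) : intProj 𝒜 k a = 0 := by
  simp [intProj, not_le.2 hk]

lemma intProj_mem (k : ℤ) (a : A) : intProj 𝒜 k a ∈ intPart 𝒜 k := by
  rcases lt_or_ge k 0 with hk | hk
  · simp [intProj_of_neg 𝒜 hk]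
  · lift k to ℕ using hk
    rw [intProj_natCast, intPart_natCast]
    exact SetLike.coe_mem _

variable {𝒜}

lemma intProj_of_mem {k : ℤ} {a : A} (ha : a ∈ intPart 𝒜 k) : intProj 𝒜 k a = a := by
  rcases lt_or_ge k 0 with hk | hk
  · rw [intPart_of_neg 𝒜 hk, Submodule.mem_bot] at ha
    simp [ha]
  · lift k to ℕ using hk
    rw [intPart_natCast] at ha
    rw [intProj_natCast, DirectSum.decompose_of_mem_same 𝒜 ha]

lemma intProj_of_mem_ne {j k : ℤ} {a : A} (ha : a ∈ intPart 𝒜 j) (hjk : j ≠ k) :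
    intProj 𝒜 k a = 0 := by
  rcases lt_or_ge j 0 with hj | hj
  · rw [intPart_of_neg 𝒜 hj, Submodule.mem_bot] at ha
    simp [ha]
  rcases lt_or_ge k 0 with hk | hk
  · exact intProj_of_neg 𝒜 hk a
  lift k to ℕ using hk
  lift j to ℕ using hj
  rw [intPart_natCast] at ha
  rw [intProj_natCast, DirectSum.decompose_of_mem_ne 𝒜 ha (by exact_mod_cast hjk)]

lemma mul_mem_intPart {j k : ℤ} {a b : A} (ha : a ∈ intPart 𝒜 j) (hb : b ∈ intPart 𝒜 k) :
    a * b ∈ intPart 𝒜 (j + k) := by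
  rcases lt_or_ge j 0 with hj | hj
  · rw [intPart_of_neg 𝒜 hj, Submodule.mem_bot] at ha
    simp [ha]
  rcases lt_or_ge k 0 with hk | hk
  · rw [intPart_of_neg 𝒜 hk, Submodule.mem_bot] at hb
    simp [hb]
  lift k to ℕ using hk
  lift j to ℕ using hj
  rw [intPart_natCast] at ha hb
  rw [← Nat.cast_add, intPart_natCast]
  exact SetLike.mul_mem_graded ha hb

variable (𝒜)

lemma exists_sum_intProj (a : A) :
    ∃ s : Finset ℤ, ∀ t : Finset ℤ, s ⊆ t → ∑ k ∈ t, intProj 𝒜 k a = a := by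
  classical
  refine ⟨(DirectSum.decompose 𝒜 a).support.map Nat.castEmbedding, fun t ht => ?_⟩
  conv_rhs => rw [← DirectSum.sum_support_decompose 𝒜 a]
  rw [← Finset.sum_subset ht, Finset.sum_map]
  · exact Finset.sum_congr rfl fun n _ => intProj_natCast 𝒜 n a
  · intro k _ hk
    rcases lt_or_ge k 0 with hk' | hk'
    · exact intProj_of_neg 𝒜 hk' a
    · lift k to ℕ using hk'
      rw [intProj_natCast]
      have : k ∉ (DirectSum.decompose 𝒜 a).support := fun h =>
        hk (Finset.mem_map_of_mem Nat.castEmbedding h)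
      simpa using this

lemma eq_zero_of_intProj {a : A} (h : ∀ k, intProj 𝒜 k a = 0) : a = 0 := by
  obtain ⟨s, hs⟩ := exists_sum_intProj 𝒜 a
  rw [← hs s subset_rfl, Finset.sum_eq_zero fun k _ => h k]

variable {𝒜}

lemma intProj_mul_of_mem_left {i : ℤ} {a : A} (ha : a ∈ intPart 𝒜 i) (k : ℤ) (b : A) :
    intProj 𝒜 k (a * b) = a * intProj 𝒜 (k - i) b := by
  obtain ⟨s, hs⟩ := exists_sum_intProj 𝒜 b
  conv_lhs => rw [← hs (insert (k - i) s) (Finset.subset_insert _ _), Finset.mul_sum, map_sum]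
  rw [Finset.sum_eq_single_of_mem (k - i) (Finset.mem_insert_self _ _)]
  · apply intProj_of_mem
    convert mul_mem_intPart ha (intProj_mem 𝒜 (k - i) b) using 2
    ring
  · intro j _ hj
    exact intProj_of_mem_ne (mul_mem_intPart ha (intProj_mem 𝒜 j b)) (by omega)

lemma intProj_mul_of_mem_right {i : ℤ} {b : A} (hb : b ∈ intPart 𝒜 i) (k : ℤ) (a : A) :
    intProj 𝒜 k (a * b) = intProj 𝒜 (k - i) a * b := by
  obtain ⟨s, hs⟩ := exists_sum_intProj 𝒜 a
  conv_lhs => rw [← hs (insert (k - i) s) (Finset.subset_insert _ _), Finset.sum_mul, map_sum]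
  rw [Finset.sum_eq_single_of_mem (k - i) (Finset.mem_insert_self _ _)]
  · apply intProj_of_mem
    convert mul_mem_intPart (intProj_mem 𝒜 (k - i) a) hb using 2
    ring
  · intro j _ hj
    exact intProj_of_mem_ne (mul_mem_intPart (intProj_mem 𝒜 j a) hb) (by omega)

/-! ### Free modules with shifted generators -/

variable {ι κ : Type*}

variable (𝒜) in
/-- The component of degree `n` of a vector in `A^ι`, whose `i`-th generator has degree `s i`. -/
def vecProj (s : ι → ℤ) (n : ℤ) : (ι → A) →ₗ[K] (ι → A) :=
  LinearMap.pi fun i => intProj 𝒜 (n - s i) ∘ₗ LinearMap.proj i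

@[simp]
lemma vecProj_apply (s : ι → ℤ) (n : ℤ) (v : ι → A) (i : ι) :
    vecProj 𝒜 s n v i = intProj 𝒜 (n - s i) (v i) := rfl

lemma vecProj_smul_of_mem {s : ι → ℤ} {k : ℤ} {a : A} (ha : a ∈ intPart 𝒜 k) (n : ℤ) (v : ι → A) :
    vecProj 𝒜 s n (a • v) = a • vecProj 𝒜 s (n - k) v := by
  ext i
  simp only [vecProj_apply, Pi.smul_apply, smul_eq_mul]
  rw [intProj_mul_of_mem_left ha, sub_right_comm]

lemma vecProj_of_mem {s : ι → ℤ} {n : ℤ} {v : ι → A} (hv : ∀ i, v i ∈ intPart 𝒜 (n - s i)) :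
    vecProj 𝒜 s n v = v :=
  funext fun i => intProj_of_mem (hv i)

lemma vecProj_of_mem_ne {s : ι → ℤ} {n m : ℤ} {v : ι → A} (hv : ∀ i, v i ∈ intPart 𝒜 (n - s i))
    (h : n ≠ m) : vecProj 𝒜 s m v = 0 :=
  funext fun i => intProj_of_mem_ne (hv i) (by omega)

variable (𝒜) in
lemma exists_sum_vecProj [Fintype ι] (s : ι → ℤ) (v : ι → A) :
    ∃ t : Finset ℤ, ∑ n ∈ t, vecProj 𝒜 s n v = v := by
  classical
  choose u hu using fun i => exists_sum_intProj 𝒜 (v i)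
  refine ⟨Finset.univ.biUnion fun i => (u i).map (Equiv.addRight (s i)).toEmbedding, ?_⟩
  ext i
  rw [Finset.sum_apply]
  simp only [vecProj_apply]
  refine (Finset.sum_map _ (Equiv.subRight (s i)).toEmbedding
    (fun k => intProj 𝒜 k (v i))).symm.trans (hu i _ fun k hk => ?_)
  simp only [Finset.mem_map_equiv, Finset.mem_biUnion, Finset.mem_univ, true_and]
  exact ⟨i, by simpa using hk⟩

variable (𝒜) in
/-- A submodule of `A^ι` is homogeneous if it contains the components of its elements. -/
def IsHomogeneousSubmodule (s : ι → ℤ) (S : Submodule A (ι → A)) : Prop :=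
  ∀ v ∈ S, ∀ n, vecProj 𝒜 s n v ∈ S

lemma isHomogeneousSubmodule_bot (s : ι → ℤ) :
    IsHomogeneousSubmodule 𝒜 s (⊥ : Submodule A (ι → A)) := by
  intro v hv n
  rw [Submodule.mem_bot] at hv ⊢
  rw [hv, map_zero]

lemma vecProj_smul (s : ι → ℤ) (a : A) :
    ∃ t : Finset ℤ, ∀ n (v : ι → A),
      vecProj 𝒜 s n (a • v) = ∑ k ∈ t, intProj 𝒜 k a • vecProj 𝒜 s (n - k) v := by
  obtain ⟨t, ht⟩ := exists_sum_intProj 𝒜 a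
  refine ⟨t, fun n v => ?_⟩
  conv_lhs => rw [← ht t subset_rfl, Finset.sum_smul, map_sum]
  exact Finset.sum_congr rfl fun k _ => vecProj_smul_of_mem (intProj_mem 𝒜 k a) n v

lemma isHomogeneousSubmodule_span_singleton {s : ι → ℤ} {d : ℤ} {z : ι → A}
    (hz : ∀ i, z i ∈ intPart 𝒜 (d - s i)) :
    IsHomogeneousSubmodule 𝒜 s (Submodule.span A {z}) := by
  intro v hv n
  obtain ⟨a, rfl⟩ := Submodule.mem_span_singleton.1 hv
  obtain ⟨t, ht⟩ := vecProj_smul (𝒜 := 𝒜) s a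
  rw [ht]
  refine Submodule.sum_mem _ fun k _ => Submodule.smul_mem _ _ ?_
  rcases eq_or_ne d (n - k) with h | h
  · rw [← h, vecProj_of_mem hz]
    exact Submodule.mem_span_singleton_self z
  · rw [vecProj_of_mem_ne hz h]
    exact Submodule.zero_mem _

/-- The linear map `A^ι → A^κ` which sends the generators to the rows of `m`. -/
def rowMap [Fintype ι] (m : ι → κ → A) : (ι → A) →ₗ[A] (κ → A) :=
  Fintype.linearCombination A m

lemma rowMap_apply [Fintype ι] (m : ι → κ → A) (v : ι → A) (j : κ) :
    rowMap m v j = ∑ i, v i * m i j := by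
  simp [rowMap, Fintype.linearCombination_apply]

lemma vecProj_rowMap [Fintype ι] {s : ι → ℤ} {t : κ → ℤ} {m : ι → κ → A}
    (hm : ∀ i j, m i j ∈ intPart 𝒜 (s i - t j)) (n : ℤ) (v : ι → A) :
    vecProj 𝒜 t n (rowMap m v) = rowMap m (vecProj 𝒜 s n v) := by
  ext j
  simp only [rowMap_apply, vecProj_apply, map_sum]
  refine Finset.sum_congr rfl fun i _ => ?_
  rw [intProj_mul_of_mem_right (hm i j), sub_sub_sub_cancel_right]

lemma isHomogeneousSubmodule_ker_rowMap [Fintype ι] {s : ι → ℤ} {t : κ → ℤ} {m : ι → κ → A}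
    (hm : ∀ i j, m i j ∈ intPart 𝒜 (s i - t j)) :
    IsHomogeneousSubmodule 𝒜 s (LinearMap.ker (rowMap m)) := by
  intro v hv n
  rw [LinearMap.mem_ker] at hv ⊢
  rw [← vecProj_rowMap hm, hv, map_zero]

/-! ### The augmentation ideal -/

variable (𝒜) in
/-- The ideal `⊕_{n ≥ 1} A_n`. -/
abbrev augIdeal : Ideal A := RingHom.ker (GradedRing.projZeroRingHom 𝒜)

lemma mem_augIdeal {a : A} : a ∈ augIdeal 𝒜 ↔ intProj 𝒜 0 a = 0 := by
  rw [RingHom.mem_ker, GradedRing.projZeroRingHom_apply, ← intProj_natCast]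
  rfl

lemma intProj_of_mem_augIdeal {a : A} (ha : a ∈ augIdeal 𝒜) {k : ℤ} (hk : k ≤ 0) :
    intProj 𝒜 k a = 0 := by
  rcases hk.lt_or_eq with hk | rfl
  · exact intProj_of_neg 𝒜 hk a
  · exact mem_augIdeal.1 ha

lemma mem_augIdeal_of_mem_intPart {a : A} {k : ℤ} (ha : a ∈ intPart 𝒜 k) (hk : k ≠ 0) :
    a ∈ augIdeal 𝒜 :=
  mem_augIdeal.2 (intProj_of_mem_ne ha hk)

lemma sub_intProj_mem_augIdeal (a : A) : a - intProj 𝒜 0 a ∈ augIdeal 𝒜 := by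
  rw [mem_augIdeal, map_sub, intProj_of_mem (intProj_mem 𝒜 0 a), sub_self]

/-- Graded Nakayama lemma. -/
lemma le_of_le_sup_augIdeal_smul [Fintype ι] {s : ι → ℤ} (hs : ∀ i, 0 ≤ s i)
    {S T : Submodule A (ι → A)}
    (hT : IsHomogeneousSubmodule 𝒜 s T) (h : S ≤ T ⊔ augIdeal 𝒜 • S) : S ≤ T := by
  -- Induction on the degree: elements of `augIdeal 𝒜` have only components of positive degree, so a
  -- component of `augIdeal 𝒜 • S` involves only lower components of `S`. Below degree `0`
  -- everything vanishes because the shifts are nonnegative.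
  have key : ∀ k : ℕ, ∀ n : ℤ, n < k → ∀ v ∈ S, vecProj 𝒜 s n v ∈ T := by
    intro k
    induction k with
    | zero =>
      intro n hn v _
      have : vecProj 𝒜 s n v = 0 := by
        ext i
        have := hs i
        exact intProj_of_neg 𝒜 (by push_cast at hn; omega) _
      rw [this]
      exact T.zero_mem
    | succ k ih =>
      intro n hn v hv
      obtain ⟨x, hx, y, hy, rfl⟩ := Submodule.mem_sup.1 (h hv)
      rw [map_add]
      refine T.add_mem (hT x hx n) ?_
      refine Submodule.smul_induction_on hy (fun a ha u hu => ?_) (fun y₁ y₂ h₁ h₂ => ?_)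
      · obtain ⟨t, ht⟩ := vecProj_smul (𝒜 := 𝒜) s a
        rw [ht]
        refine Submodule.sum_mem _ fun j _ => ?_
        rcases le_or_gt j 0 with hj | hj
        · rw [intProj_of_mem_augIdeal ha hj, zero_smul]
          exact T.zero_mem
        · exact T.smul_mem _ (ih (n - j) (by push_cast at hn; omega) u hu)
      · rw [map_add]
        exact T.add_mem h₁ h₂
  intro v hv
  obtain ⟨t, ht⟩ := exists_sum_vecProj 𝒜 s v
  rw [← ht]
  refine Submodule.sum_mem _ fun n _ => ?_
  exact key (n.toNat + 1) n (by omega) v hv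

end GradedParts

/-! ### A basis of the component of degree one. -/

section DegreeOne

variable {K : Type v} [Field K] {A : Type u} [Ring A] [Algebra K A] {𝒜 : ℕ → Submodule K A}

lemma intPart_zero_eq : intPart 𝒜 0 = 𝒜 0 := intPart_natCast 𝒜 0

lemma intPart_one_eq : intPart 𝒜 1 = 𝒜 1 := intPart_natCast 𝒜 1

lemma map_degreeOneLift_pow (n : ℕ) :
    (LinearMap.range (TensorAlgebra.ι K (M := 𝒜 1)) ^ n).map (degreeOneLift 𝒜).toLinearMap =
      𝒜 1 ^ n := by
  rw [Submodule.map_pow, ← LinearMap.range_comp]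
  congr 1
  have : (degreeOneLift 𝒜).toLinearMap ∘ₗ TensorAlgebra.ι K = (𝒜 1).subtype := by
    ext x
    simp [degreeOneLift]
  rw [this, Submodule.range_subtype]

variable {g : ℕ} (y : Module.Basis (Fin g) K (𝒜 1))

lemma exists_sum_mul_basis_of_mem_mul {S : Submodule K A} {a : A} (ha : a ∈ S * 𝒜 1) :
    ∃ c : Fin g → A, (∀ j, c j ∈ S) ∧ a = ∑ j, c j * (y j : A) := by
  induction ha using Submodule.mul_induction_on' with
  | mem_mul_mem s hs t ht =>
    refine ⟨fun j => y.repr ⟨t, ht⟩ j • s, fun j => S.smul_mem _ hs, ?_⟩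
    have := congrArg (Submodule.subtype _) (y.sum_repr ⟨t, ht⟩)
    simp only [map_sum, map_smul, Submodule.subtype_apply] at this
    conv_lhs => rw [← this, Finset.mul_sum]
    simp
  | add a _ b _ hc hd =>
    obtain ⟨c, hc, rfl⟩ := hc
    obtain ⟨d, hd, rfl⟩ := hd
    exact ⟨c + d, fun j => S.add_mem (hc j) (hd j), by simp [add_mul, Finset.sum_add_distrib]⟩

lemma exists_sum_basis_mul_of_mem_mul {S : Submodule K A} {a : A} (ha : a ∈ 𝒜 1 * S) :
    ∃ c : Fin g → A, (∀ j, c j ∈ S) ∧ a = ∑ j, (y j : A) * c j := by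
  induction ha using Submodule.mul_induction_on' with
  | mem_mul_mem t ht s hs =>
    refine ⟨fun j => y.repr ⟨t, ht⟩ j • s, fun j => S.smul_mem _ hs, ?_⟩
    have := congrArg (Submodule.subtype _) (y.sum_repr ⟨t, ht⟩)
    simp only [map_sum, map_smul, Submodule.subtype_apply] at this
    conv_lhs => rw [← this, Finset.sum_mul]
    simp
  | add a _ b _ hc hd =>
    obtain ⟨c, hc, rfl⟩ := hc
    obtain ⟨d, hd, rfl⟩ := hd
    exact ⟨c + d, fun j => S.add_mem (hc j) (hd j), by simp [mul_add, Finset.sum_add_distrib]⟩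

lemma basis_mem_intPart (j : Fin g) : (y j : A) ∈ intPart 𝒜 1 := by
  rw [intPart_one_eq]
  exact SetLike.coe_mem _

/-- The map `A^g → A` with image the augmentation ideal. -/
def genMap : (Fin g → A) →ₗ[A] A := Fintype.linearCombination A fun j => (y j : A)

lemma genMap_apply (v : Fin g → A) : genMap y v = ∑ j, v j * (y j : A) := by
  simp [genMap, Fintype.linearCombination_apply]

end DegreeOne

/-! ### Connected algebras generated in degree one. -/

section Connected

variable {K : Type v} [Field K] {A : Type u} [Ring A] [Algebra K A]
  {𝒜 : ℕ → Submodule K A} [GradedAlgebra 𝒜]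

lemma algebraMap_mem_intPart_zero (c : K) : algebraMap K A c ∈ intPart 𝒜 0 := by
  have : intPart 𝒜 0 = 𝒜 0 := intPart_natCast 𝒜 0
  rw [this, Algebra.algebraMap_eq_smul_one]
  exact (𝒜 0).smul_mem c (SetLike.one_mem_graded 𝒜)

lemma IsGrAlg.exists_algebraMap (hG : IsGrAlg 𝒜) {a : A} (ha : a ∈ intPart 𝒜 0) :
    ∃ c : K, algebraMap K A c = a := by
  rw [intPart_zero_eq, hG.connected, Submodule.mem_span_singleton] at ha
  obtain ⟨c, rfl⟩ := ha
  exact ⟨c, Algebra.algebraMap_eq_smul_one c⟩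

lemma IsGrAlg.eq_zero_of_mem_augIdeal (hG : IsGrAlg 𝒜) {c : K}
    (hc : algebraMap K A c ∈ augIdeal 𝒜) : c = 0 := by
  have := hG.nontrivial
  rw [mem_augIdeal, intProj_of_mem (algebraMap_mem_intPart_zero c)] at hc
  exact (algebraMap K A).injective (by simpa using hc)

lemma IsGrAlg.exists_sub_mem_augIdeal (hG : IsGrAlg 𝒜) (a : A) :
    ∃ c : K, a - algebraMap K A c ∈ augIdeal 𝒜 := by
  obtain ⟨c, hc⟩ := hG.exists_algebraMap (intProj_mem 𝒜 0 a)
  exact ⟨c, by rw [hc]; exact sub_intProj_mem_augIdeal a⟩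

lemma pow_one_le (n : ℕ) : 𝒜 1 ^ n ≤ 𝒜 n := by
  induction n with
  | zero =>
    rw [pow_zero, Submodule.one_le]
    exact SetLike.one_mem_graded 𝒜
  | succ n ih =>
    rw [pow_succ, Submodule.mul_le]
    intro a ha b hb
    exact SetLike.mul_mem_graded (ih ha) hb

/-- Lift an element to the tensor algebra and split the lift into tensor degrees; the piece of
degree `k` lands in `𝒜 1 ^ k ≤ 𝒜 k`, so only `k = n` contributes. -/
lemma IsGrAlg.part_eq_pow (hG : IsGrAlg 𝒜) (n : ℕ) : 𝒜 n = 𝒜 1 ^ n := by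
  classical
  refine le_antisymm (fun a ha => ?_) (pow_one_le n)
  obtain ⟨t, rfl⟩ := hG.generated a
  have hk : ∀ k, degreeOneLift 𝒜 (DirectSum.decompose
      (LinearMap.range (TensorAlgebra.ι K (M := 𝒜 1)) ^ ·) t k : TensorAlgebra K (𝒜 1)) ∈
        𝒜 1 ^ k := fun k => by
    rw [← map_degreeOneLift_pow]
    exact Submodule.mem_map_of_mem (SetLike.coe_mem _)
  have hsum := congrArg (degreeOneLift 𝒜) (DirectSum.sum_support_decompose
    (LinearMap.range (TensorAlgebra.ι K (M := 𝒜 1)) ^ ·) t)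
  rw [map_sum] at hsum
  rw [← DirectSum.decompose_of_mem_same 𝒜 ha, ← hsum, DirectSum.decompose_sum,
    DFinsupp.finsetSum_apply, AddSubmonoidClass.coe_finsetSum]
  refine Submodule.sum_mem _ fun k _ => ?_
  rcases eq_or_ne k n with rfl | h
  · rw [DirectSum.decompose_of_mem_same 𝒜 (pow_one_le k (hk k))]
    exact hk k
  · rw [DirectSum.decompose_of_mem_ne 𝒜 (pow_one_le k (hk k)) h]
    exact Submodule.zero_mem _

variable {g : ℕ} (y : Module.Basis (Fin g) K (𝒜 1))

lemma IsGrAlg.exists_sum_mul_basis (hG : IsGrAlg 𝒜) {k : ℤ} (hk : k ≠ 0) {a : A}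
    (ha : a ∈ intPart 𝒜 k) :
    ∃ c : Fin g → A, (∀ j, c j ∈ intPart 𝒜 (k - 1)) ∧ a = ∑ j, c j * (y j : A) := by
  rcases lt_or_ge k 0 with h | h
  · rw [intPart_of_neg 𝒜 h, Submodule.mem_bot] at ha
    exact ⟨0, fun _ => Submodule.zero_mem _, by simp [ha]⟩
  obtain ⟨n, rfl⟩ : ∃ n : ℕ, k = (n + 1 : ℕ) := ⟨(k - 1).toNat, by omega⟩
  rw [intPart_natCast, hG.part_eq_pow, pow_succ] at ha
  obtain ⟨c, hc, h⟩ := exists_sum_mul_basis_of_mem_mul y ha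
  refine ⟨c, fun j => ?_, h⟩
  have : ((n + 1 : ℕ) : ℤ) - 1 = n := by push_cast; ring
  rw [this, intPart_natCast, hG.part_eq_pow]
  exact hc j

lemma IsGrAlg.exists_sum_basis_mul (hG : IsGrAlg 𝒜) {k : ℤ} (hk : k ≠ 0) {a : A}
    (ha : a ∈ intPart 𝒜 k) :
    ∃ c : Fin g → A, (∀ j, c j ∈ intPart 𝒜 (k - 1)) ∧ a = ∑ j, (y j : A) * c j := by
  rcases lt_or_ge k 0 with h | h
  · rw [intPart_of_neg 𝒜 h, Submodule.mem_bot] at ha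
    exact ⟨0, fun _ => Submodule.zero_mem _, by simp [ha]⟩
  obtain ⟨n, rfl⟩ : ∃ n : ℕ, k = (n + 1 : ℕ) := ⟨(k - 1).toNat, by omega⟩
  rw [intPart_natCast, hG.part_eq_pow, pow_succ'] at ha
  obtain ⟨c, hc, h⟩ := exists_sum_basis_mul_of_mem_mul y ha
  refine ⟨c, fun j => ?_, h⟩
  have : ((n + 1 : ℕ) : ℤ) - 1 = n := by push_cast; ring
  rw [this, intPart_natCast, hG.part_eq_pow]
  exact hc j

lemma genMap_mem_augIdeal (v : Fin g → A) : genMap y v ∈ augIdeal 𝒜 := by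
  rw [genMap_apply]
  exact Ideal.sum_mem _ fun j _ => Ideal.mul_mem_left _ _
    (mem_augIdeal_of_mem_intPart (basis_mem_intPart y j) one_ne_zero)

lemma IsGrAlg.exists_genMap_eq (hG : IsGrAlg 𝒜) {a : A} (ha : a ∈ augIdeal 𝒜) :
    ∃ v, genMap y v = a := by
  obtain ⟨s, hs⟩ := exists_sum_intProj 𝒜 a
  rw [← hs s subset_rfl]
  change _ ∈ LinearMap.range (genMap y)
  refine Submodule.sum_mem _ fun k _ => ?_
  rcases eq_or_ne k 0 with rfl | hk
  · rw [mem_augIdeal.1 ha]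
    exact Submodule.zero_mem _
  · obtain ⟨c, -, hc⟩ := hG.exists_sum_mul_basis y hk (intProj_mem 𝒜 k a)
    exact ⟨c, by rw [hc, genMap_apply]⟩

end Connected

/-! ### Vanishing of `Ext` as exactness of the dual complex. -/

section Homology

open Abelian

variable {K : Type v} [Field K] {A : Type u} [Ring A] [Algebra K A]
  {𝒜 : ℕ → Submodule K A} [GradedAlgebra 𝒜] {g : ℕ} (y : Module.Basis (Fin g) K (𝒜 1))

/-- Such an `a` is the image of `1` under a map from the trivial module to `A`, and `Hom(K, A) =
Ext^0(K, A) = 0`. -/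
lemma IsGorenstein.eq_zero_of_augIdeal_mul {D : ℕ} (hA : IsGorenstein 𝒜 (D + 1)) {a : A}
    (ha : ∀ s ∈ augIdeal 𝒜, s * a = 0) : a = 0 := by
  have := hA.ext_eq_zero 0 (by omega)
  let h : (A ⧸ augIdeal 𝒜) →ₗ[A] A := (augIdeal 𝒜).liftQ (LinearMap.toSpanSingleton A A a)
    fun s hs => by simpa using ha s hs
  have h0 : ModuleCat.ofHom h = 0 :=
    (Ext.mk₀_bijective (trivialModule 𝒜) (ModuleCat.of A A)).1 (Subsingleton.elim _ _)
  have := congrArg (fun t => t.hom (Submodule.Quotient.mk 1)) h0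
  change LinearMap.toSpanSingleton A A a 1 = 0 at this
  simpa using this

variable (𝒜) in
/-- The augmentation ideal as a kernel, the first syzygy of the trivial module. -/
abbrev augKer : Submodule A A := LinearMap.ker (augIdeal 𝒜).mkQ

lemma mem_augKer {a : A} : a ∈ augKer 𝒜 ↔ a ∈ augIdeal 𝒜 := by
  rw [augKer, Submodule.ker_mkQ]

/-- The surjection of `A^g` on the augmentation ideal. -/
def genCover : (Fin g → A) →ₗ[A] augKer 𝒜 :=
  (genMap y).codRestrict _ fun v =>
    mem_augKer.2 (genMap_mem_augIdeal y v)

lemma IsGrAlg.genCover_surjective (hG : IsGrAlg 𝒜) : Function.Surjective (genCover y) := by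
  rintro ⟨a, ha⟩
  obtain ⟨v, hv⟩ := hG.exists_genMap_eq y (mem_augKer.1 ha)
  exact ⟨v, Subtype.ext hv⟩

lemma ker_genCover : LinearMap.ker (genCover y) = LinearMap.ker (genMap y) :=
  LinearMap.ker_codRestrict _ _ _

/-- Exactness of the dual complex at `A^g`. The form given by `c` descends to the augmentation ideal
and, as `Ext^1(K, A) = 0`, extends to `A`, where a left linear form is right multiplication by its
value at `1`. -/
lemma IsRegularAlgebra.exists_right_factor {D : ℕ} (hA : IsRegularAlgebra 𝒜 (D + 2))
    (c : Fin g → A) (hc : ∀ v, genMap y v = 0 → ∑ j, v j * c j = 0) :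
    ∃ a, ∀ j, c j = y j * a := by
  have := hA.gorenstein.ext_eq_zero 1 (by omega)
  have : Subsingleton (Ext (ModuleCat.of A (A ⧸ augIdeal 𝒜)) (ModuleCat.of A A) 1) := this
  obtain ⟨k, hk⟩ := exists_factor_of_ker_le (hA.grAlg.genCover_surjective y)
    (Fintype.linearCombination A c) (by
      rw [ker_genCover]
      intro v hv
      simpa [Fintype.linearCombination_apply] using hc v hv)
  obtain ⟨h', hh⟩ := exists_extension_of_ext_one (Submodule.mkQ_surjective (augIdeal 𝒜)) k
  refine ⟨h' 1, fun j => ?_⟩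
  have h1 := hk (Pi.single j 1)
  rw [← hh] at h1
  have h2 : ((genCover y (Pi.single j 1) : augKer 𝒜) : A) = y j := by
    change genMap y _ = _
    simp [genMap]
  rw [h2] at h1
  rw [← smul_eq_mul, ← map_smul, smul_eq_mul, mul_one, h1]
  simp

variable {r : ℕ} {m : Fin r → Fin g → A}

/-- The surjection of `A^r` on the module of relations. -/
def relCover (hm : Submodule.span A (Set.range m) = LinearMap.ker (genMap y)) :
    (Fin r → A) →ₗ[A] LinearMap.ker (genCover y) :=
  (rowMap m).codRestrict _ fun v => by
    rw [ker_genCover, ← hm, ← Fintype.range_linearCombination]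
    exact LinearMap.mem_range_self _ v

lemma relCover_surjective (hm : Submodule.span A (Set.range m) = LinearMap.ker (genMap y)) :
    Function.Surjective (relCover y hm) := by
  rintro ⟨a, ha⟩
  rw [ker_genCover, ← hm, ← Fintype.range_linearCombination] at ha
  obtain ⟨v, hv⟩ := ha
  exact ⟨v, Subtype.ext hv⟩

lemma ker_relCover (hm : Submodule.span A (Set.range m) = LinearMap.ker (genMap y)) :
    LinearMap.ker (relCover y hm) = LinearMap.ker (rowMap m) :=
  LinearMap.ker_codRestrict _ _ _

/-- Exactness of the dual complex at `A^r`: the form given by `b` descends to the module of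
relations and extends to `A^g`, the obstruction lying in `Ext^1` of the augmentation ideal, that is
in `Ext^2(K, A) = 0`. -/
lemma IsRegularAlgebra.exists_row_factor {D : ℕ} (hA : IsRegularAlgebra 𝒜 (D + 3))
    (hm : Submodule.span A (Set.range m) = LinearMap.ker (genMap y))
    (b : Fin r → A) (hb : ∀ u, rowMap m u = 0 → ∑ i, u i * b i = 0) :
    ∃ c : Fin g → A, ∀ i, b i = ∑ j, m i j * c j := by
  have := hA.gorenstein.ext_eq_zero 2 (by omega)
  have h1 : Subsingleton (Ext (ModuleCat.of A (A ⧸ augIdeal 𝒜)) (ModuleCat.of A A) 2) := this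
  have h2 := subsingleton_ext_ker (Submodule.mkQ_surjective (augIdeal 𝒜)) h1
  obtain ⟨k, hk⟩ := exists_factor_of_ker_le (relCover_surjective y hm)
    (Fintype.linearCombination A b) (by
      rw [ker_relCover]
      intro v hv
      simpa [Fintype.linearCombination_apply] using hb v hv)
  obtain ⟨h', hh⟩ := exists_extension_of_ext_one (hA.grAlg.genCover_surjective y) k
  refine ⟨fun j => h' (Pi.single j 1), fun i => ?_⟩
  have h1 := hk (Pi.single i 1)
  rw [← hh] at h1
  have h2 : ((relCover y hm (Pi.single i 1) : LinearMap.ker (genCover y)) : Fin g → A) = m i := by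
    change rowMap m _ = _
    simp [rowMap]
  rw [h2] at h1
  have h3 : b i = h' (m i) := by rw [h1]; simp
  rw [h3]
  conv_lhs => rw [pi_eq_sum_univ' (m i)]
  simp [map_sum]

/-- The kernel is a third syzygy of a module of projective dimension at most `3`. -/
lemma IsRegularAlgebra.projective_ker_rowMap (hA : IsRegularAlgebra 𝒜 3)
    (hm : Submodule.span A (Set.range m) = LinearMap.ker (genMap y)) :
    Module.Projective A (LinearMap.ker (rowMap m)) := by
  have h0 : projectiveDimension (trivialModule 𝒜) ≤ ((3 : ℕ) : WithBot ℕ∞) := by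
    rw [← hA.globalDimension_eq]
    exact le_iSup (fun M : ModuleCat.{u} A => projectiveDimension M) _
  rw [projectiveDimension_le_iff] at h0
  have h1 : HasProjectiveDimensionLT (ModuleCat.of A (augKer 𝒜)) 3 :=
    hasProjectiveDimensionLT_ker (Submodule.mkQ_surjective (augIdeal 𝒜)) h0
  have h2 := hasProjectiveDimensionLT_ker (hA.grAlg.genCover_surjective y) h1
  have h3 := hasProjectiveDimensionLT_ker (relCover_surjective y hm) h2
  rw [ker_relCover] at h3
  have := projective_iff_hasProjectiveDimensionLT_one.2 h3
  exact (IsProjective.iff_projective _).2 this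

/-- Two shifts and one connecting map present `Ext^3(K, A)` as the dual of the third syzygy modulo
the forms that come from `A^r`. -/
lemma IsRegularAlgebra.exists_dual_ker (hA : IsRegularAlgebra 𝒜 3)
    (hm : Submodule.span A (Set.range m) = LinearMap.ker (genMap y)) :
    ∃ θ : (LinearMap.ker (rowMap m) →ₗ[A] A) →+ 𝒜 0, Function.Surjective θ ∧
      (∀ h a, θ (LinearMap.toSpanSingleton A A a ∘ₗ h) =
        θ h * GradedRing.projZeroRingHom' 𝒜 a) ∧
      ∀ h, θ h = 0 → ∃ t : Fin r → A, ∀ x : LinearMap.ker (rowMap m), h x = ∑ i, x.1 i * t i := by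
  obtain ⟨φ, hφ⟩ := hA.gorenstein.ext_top
  obtain ⟨φ₁, hφ₁⟩ := exists_addEquiv_ext_ker (Submodule.mkQ_surjective (augIdeal 𝒜))
    (fun a b => b * GradedRing.projZeroRingHom' 𝒜 a) φ hφ
  obtain ⟨φ₂, hφ₂⟩ := exists_addEquiv_ext_ker (n := 0) (hA.grAlg.genCover_surjective y)
    (fun a b => b * GradedRing.projZeroRingHom' 𝒜 a) φ₁ hφ₁
  have := exists_addHom_dual_ker (relCover_surjective y hm)
    (fun a b => b * GradedRing.projZeroRingHom' 𝒜 a) φ₂ hφ₂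
  rw [ker_relCover] at this
  obtain ⟨θ, h1, h2, h3⟩ := this
  refine ⟨θ, h1, h2, fun h hh => ?_⟩
  obtain ⟨h', hh'⟩ := h3 h hh
  refine ⟨fun i => h' (Pi.single i 1), fun x => ?_⟩
  rw [← hh']
  conv_lhs => rw [pi_eq_sum_univ' x.1]
  simp [map_sum]

end Homology

/-! ### From a presentation of the algebra to generators of the module of relations, by Fox
derivatives. -/

section Relations

variable {K : Type v} [Field K] {A : Type u} [Ring A] [Algebra K A]
  {𝒜 : ℕ → Submodule K A} {g : ℕ} (y : Module.Basis (Fin g) K (𝒜 1))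

/-- The coordinates of an element of `A_1`, as scalars in `A`. -/
def coordVec (x : 𝒜 1) : Fin g → A := fun j => algebraMap K A (y.repr x j)

/-- The action of `T(A_1)` on `A^g × K` for which `x ∈ A_1` sends `(v, s)` to
`(x v + s (coordinates of x), 0)`. -/
def foxAction : TensorAlgebra K (𝒜 1) →ₐ[K] Module.End K ((Fin g → A) × K) :=
  TensorAlgebra.lift K (LinearMap.mk₂ K
    (fun (x : 𝒜 1) (p : (Fin g → A) × K) => ((x : A) • p.1 + p.2 • coordVec y x, (0 : K)))
    (fun x x' p => by
      ext j
      · simp [coordVec, add_mul]; abel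
      · simp)
    (fun c x p => by
      ext j
      · simp [coordVec, Algebra.smul_def, mul_add]
        rw [← mul_assoc, ← mul_assoc, Algebra.commutes, ← mul_assoc (algebraMap K A c),
          Algebra.commutes c (algebraMap K A p.2)]
      · simp)
    (fun x p p' => by
      ext j
      · simp [add_smul]; abel
      · simp)
    (fun c x p => by
      ext j
      · simp [mul_smul, smul_add]
      · simp))

/-- The vector of (right) partial derivatives in `A^g` of a noncommutative polynomial. -/
def foxDeriv (t : TensorAlgebra K (𝒜 1)) : Fin g → A := (foxAction y t (0, 1)).1

/-- The constant term of a noncommutative polynomial. -/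
def constTerm (t : TensorAlgebra K (𝒜 1)) : K := (foxAction y t (0, 1)).2

lemma foxAction_ι (x : 𝒜 1) (v : Fin g → A) (s : K) :
    foxAction y (TensorAlgebra.ι K x) (v, s) = ((x : A) • v + s • coordVec y x, 0) := by
  simp [foxAction]

lemma foxDeriv_ι (x : 𝒜 1) : foxDeriv y (TensorAlgebra.ι K x) = coordVec y x := by
  simp [foxDeriv, foxAction_ι]

lemma constTerm_ι (x : 𝒜 1) : constTerm y (TensorAlgebra.ι K x) = 0 := by
  simp [constTerm, foxAction_ι]

lemma degreeOneLift_ι (x : 𝒜 1) : degreeOneLift 𝒜 (TensorAlgebra.ι K x) = x := by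
  simp [degreeOneLift]

/-- Each `t` acts as a triangular block matrix with diagonal entries its image in `A` and its
constant term, and with its derivative off the diagonal. Multiplying such matrices yields the
product rule `foxDeriv_mul`. -/
lemma foxAction_apply (t : TensorAlgebra K (𝒜 1)) (v : Fin g → A) (s : K) :
    foxAction y t (v, s) = (degreeOneLift 𝒜 t • v + s • foxDeriv y t, s * constTerm y t) := by
  induction t using TensorAlgebra.induction generalizing v s with
  | algebraMap c =>
    simp [foxDeriv, constTerm, mul_comm]
  | ι x => rw [foxAction_ι, foxDeriv_ι, constTerm_ι, degreeOneLift_ι, mul_zero]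
  | mul a b ha hb =>
    have h : ∀ w, foxAction y (a * b) w = foxAction y a (foxAction y b w) := fun w => by
      rw [map_mul, Module.End.mul_apply]
    have hD : foxDeriv y (a * b) =
        degreeOneLift 𝒜 a • foxDeriv y b + constTerm y b • foxDeriv y a := by
      rw [foxDeriv, h, hb, ha]
      simp
    have hC : constTerm y (a * b) = constTerm y b * constTerm y a := by
      rw [constTerm, h, hb, ha]
      simp
    rw [h, hb, ha, hD, hC, map_mul, smul_add, smul_add, smul_smul, smul_smul, ← add_assoc,
      mul_assoc, smul_comm s (degreeOneLift 𝒜 a)]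
  | add a b ha hb =>
    have hD : foxDeriv y (a + b) = foxDeriv y a + foxDeriv y b := by
      simp [foxDeriv]
    have hC : constTerm y (a + b) = constTerm y a + constTerm y b := by
      simp [constTerm]
    rw [map_add, LinearMap.add_apply, ha, hb, hD, hC, map_add]
    ext j
    · simp [add_mul]; abel
    · simp [mul_add]

lemma foxDeriv_mul (a b : TensorAlgebra K (𝒜 1)) : foxDeriv y (a * b) =
    degreeOneLift 𝒜 a • foxDeriv y b + constTerm y b • foxDeriv y a := by
  rw [foxDeriv, map_mul, Module.End.mul_apply, foxAction_apply y b, foxAction_apply y a]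
  simp

lemma foxDeriv_add (a b : TensorAlgebra K (𝒜 1)) :
    foxDeriv y (a + b) = foxDeriv y a + foxDeriv y b := by
  simp [foxDeriv]

lemma foxDeriv_zero : foxDeriv y (0 : TensorAlgebra K (𝒜 1)) = 0 := by
  simp [foxDeriv]

lemma constTerm_mul (a b : TensorAlgebra K (𝒜 1)) :
    constTerm y (a * b) = constTerm y b * constTerm y a := by
  rw [constTerm, map_mul, Module.End.mul_apply, foxAction_apply y b, foxAction_apply y a]
  simp

lemma genMap_coordVec (x : 𝒜 1) : genMap y (coordVec y x) = x := by
  have := congrArg (Submodule.subtype _) (y.sum_repr x)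
  simp only [map_sum, map_smul, Submodule.subtype_apply] at this
  rw [genMap_apply]
  simp only [coordVec]
  rw [← this]
  exact Finset.sum_congr rfl fun j _ => (Algebra.smul_def _ _).symm

/-- Euler's formula: up to its constant term, a polynomial is the sum of its derivatives times the
generators. -/
lemma genMap_foxDeriv (t : TensorAlgebra K (𝒜 1)) :
    genMap y (foxDeriv y t) = degreeOneLift 𝒜 t - algebraMap K A (constTerm y t) := by
  induction t using TensorAlgebra.induction with
  | algebraMap c =>
    simp [foxDeriv, constTerm]
  | ι x => rw [foxDeriv_ι, constTerm_ι, degreeOneLift_ι, genMap_coordVec, map_zero, sub_zero]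
  | mul a b ha hb =>
    rw [foxDeriv_mul, constTerm_mul, map_add, map_smul, LinearMap.map_smul_of_tower, ha, hb,
      map_mul, map_mul, Algebra.smul_def, smul_eq_mul]
    rw [mul_sub, mul_sub, ← Algebra.commutes (constTerm y b) (degreeOneLift 𝒜 a)]
    abel
  | add a b ha hb =>
    have hC : constTerm y (a + b) = constTerm y a + constTerm y b := by
      simp [constTerm]
    rw [foxDeriv_add, map_add, ha, hb, hC, map_add, map_add]
    abel

variable [GradedAlgebra 𝒜]

lemma IsGrAlg.constTerm_eq_zero (hG : IsGrAlg 𝒜) {t : TensorAlgebra K (𝒜 1)}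
    (ht : degreeOneLift 𝒜 t = 0) : constTerm y t = 0 := by
  refine hG.eq_zero_of_mem_augIdeal ?_
  have := genMap_mem_augIdeal y (foxDeriv y t)
  rw [genMap_foxDeriv, ht, zero_sub] at this
  exact neg_mem_iff.1 this

lemma foxDeriv_mem_intPart {n : ℕ} {t : TensorAlgebra K (𝒜 1)}
    (ht : t ∈ LinearMap.range (TensorAlgebra.ι K (M := 𝒜 1)) ^ (n + 1)) (j : Fin g) :
    foxDeriv y t j ∈ intPart 𝒜 n := by
  rw [pow_succ] at ht
  induction ht using Submodule.mul_induction_on' with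
  | mem_mul_mem a ha b hb =>
    obtain ⟨x, rfl⟩ := hb
    rw [foxDeriv_mul, foxDeriv_ι, constTerm_ι, zero_smul, add_zero, Pi.smul_apply, smul_eq_mul]
    have h1 : degreeOneLift 𝒜 a ∈ intPart 𝒜 n := by
      rw [intPart_natCast]
      refine pow_one_le n ?_
      rw [← map_degreeOneLift_pow]
      exact Submodule.mem_map_of_mem ha
    have := mul_mem_intPart h1 (algebraMap_mem_intPart_zero (𝒜 := 𝒜) (y.repr x j))
    rwa [add_zero] at this
  | add a _ b _ ha hb =>
    rw [foxDeriv_add]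
    exact Submodule.add_mem _ ha hb

/-- A finite presentation yields finitely many homogeneous generators of the module of
relations. -/
lemma IsGrAlg.exists_relations (hG : IsGrAlg 𝒜) :
    ∃ (r : ℕ) (n : Fin r → ℤ) (m : Fin r → Fin g → A), (∀ i, 2 ≤ n i) ∧
      (∀ i j, m i j ∈ intPart 𝒜 (n i - 1)) ∧
      Submodule.span A (Set.range m) = LinearMap.ker (genMap y) := by
  obtain ⟨R, hR, hker⟩ := hG.presented
  have hmem : ∀ t, t ∈ TwoSidedIdeal.span (R : Set (TensorAlgebra K (𝒜 1))) ↔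
      degreeOneLift 𝒜 t = 0 := fun t => by
    rw [← hker, TwoSidedIdeal.mem_ker]
  choose n hn2 hn using fun i : Fin R.card => hR _ (R.equivFin.symm i).2
  refine ⟨R.card, fun i => n i, fun i => foxDeriv y (R.equivFin.symm i : TensorAlgebra K (𝒜 1)),
    fun i => Nat.ofNat_le_cast.2 (hn2 i), fun i j => ?_, le_antisymm ?_ fun v hv => ?_⟩
  · obtain ⟨k, hk⟩ : ∃ k, n i = k + 1 := ⟨n i - 1, by have := hn2 i; omega⟩
    have h := hn i
    rw [hk] at h
    have := foxDeriv_mem_intPart y h j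
    simpa [hk] using this
  · rw [Submodule.span_le]
    rintro _ ⟨i, rfl⟩
    have h0 : degreeOneLift 𝒜 (R.equivFin.symm i : TensorAlgebra K (𝒜 1)) = 0 :=
      (hmem _).1 (TwoSidedIdeal.subset_span (R.equivFin.symm i).2)
    rw [SetLike.mem_coe, LinearMap.mem_ker, genMap_foxDeriv, h0, hG.constTerm_eq_zero y h0,
      map_zero, sub_zero]
  · set S := Submodule.span A (Set.range fun i : Fin R.card =>
      foxDeriv y (R.equivFin.symm i : TensorAlgebra K (𝒜 1))) with hS
    -- On elements that vanish in `A` the product rule loses one of its terms on either side, so the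
    -- condition on derivatives cuts out a two-sided ideal. It contains the relators, hence the
    -- whole kernel.
    let J : TwoSidedIdeal (TensorAlgebra K (𝒜 1)) :=
      TwoSidedIdeal.mk' {t | degreeOneLift 𝒜 t = 0 ∧ foxDeriv y t ∈ S}
        ⟨map_zero _, by rw [foxDeriv_zero]; exact S.zero_mem⟩
        (fun ha hb => ⟨by rw [map_add, ha.1, hb.1, add_zero],
          by rw [foxDeriv_add]; exact S.add_mem ha.2 hb.2⟩)
        (fun {a} ha => ⟨by rw [map_neg, ha.1, neg_zero], by
          have : foxDeriv y (-a) = -foxDeriv y a := by simp [foxDeriv]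
          rw [this]; exact S.neg_mem ha.2⟩)
        (fun {a b} hb => ⟨by rw [map_mul, hb.1, mul_zero], by
          rw [foxDeriv_mul, hG.constTerm_eq_zero y hb.1, zero_smul, add_zero]
          exact S.smul_mem _ hb.2⟩)
        (fun {a b} ha => ⟨by rw [map_mul, ha.1, zero_mul], by
          rw [foxDeriv_mul, ha.1, zero_smul, zero_add]
          exact S.smul_of_tower_mem _ ha.2⟩)
    have hJ : TwoSidedIdeal.span (R : Set (TensorAlgebra K (𝒜 1))) ≤ J := by
      rw [TwoSidedIdeal.span_le]
      intro ρ hρ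
      rw [SetLike.mem_coe, TwoSidedIdeal.mem_mk']
      exact ⟨(hmem ρ).1 (TwoSidedIdeal.subset_span hρ),
        Submodule.subset_span ⟨R.equivFin ⟨ρ, hρ⟩, by simp⟩⟩
    -- A syzygy `v` is the derivative of an element of the kernel: lift its entries and multiply
    -- them by the generators.
    choose t ht using fun j => hG.generated (v j)
    have hD : foxDeriv y (∑ j, t j * TensorAlgebra.ι K (y j)) = v := by
      have : ∀ s : Finset (Fin g), foxDeriv y (∑ j ∈ s, t j * TensorAlgebra.ι K (y j)) =
          ∑ j ∈ s, v j • Pi.single j (1 : A) := by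
        intro s
        induction s using Finset.cons_induction with
        | empty => simp [foxDeriv_zero]
        | cons j s hj ih =>
          rw [Finset.sum_cons, Finset.sum_cons, foxDeriv_add, ih, foxDeriv_mul, foxDeriv_ι,
            constTerm_ι, zero_smul, add_zero, ht]
          congr 2
          ext k
          simp [coordVec, Finsupp.single_apply, Pi.single_apply, eq_comm]
      rw [this]
      exact (pi_eq_sum_univ' v).symm
    have h0 : ∑ j, t j * TensorAlgebra.ι K (y j) ∈ J := by
      refine hJ ((hmem _).2 ?_)
      rw [map_sum, ← LinearMap.mem_ker.1 hv, genMap_apply]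
      exact Finset.sum_congr rfl fun j _ => by rw [map_mul, ht, degreeOneLift_ι]
    rw [TwoSidedIdeal.mem_mk'] at h0
    rw [← hD]
    exact h0.2

/-- A family of homogeneous generators of the module of relations, of minimal cardinality. -/
lemma IsGrAlg.exists_minimal_relations (hG : IsGrAlg 𝒜) :
    ∃ (r : ℕ) (n : Fin r → ℤ) (m : Fin r → Fin g → A), (∀ i, 2 ≤ n i) ∧
      (∀ i j, m i j ∈ intPart 𝒜 (n i - 1)) ∧
      Submodule.span A (Set.range m) = LinearMap.ker (genMap y) ∧
      ∀ v ∈ LinearMap.ker (rowMap m), ∀ i, v i ∈ augIdeal 𝒜 := by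
  classical
  have hex := hG.exists_relations y
  obtain ⟨n, m, hn, hm, hspan⟩ := Nat.find_spec hex
  have hmin := fun k (hk : k < Nat.find hex) => Nat.find_min hex hk
  generalize Nat.find hex = r at n m hn hm hspan hmin
  refine ⟨r, n, m, hn, hm, hspan, fun v hv i => ?_⟩
  by_contra hvi
  rw [mem_augIdeal] at hvi
  obtain ⟨r, rfl⟩ : ∃ r', r = r' + 1 := ⟨r - 1, by have := i.2; omega⟩
  refine hmin r (by omega) ⟨n ∘ i.succAbove, m ∘ i.succAbove, fun _ => hn _, fun _ _ => hm _ _, ?_⟩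
  rw [← hspan]
  refine le_antisymm (Submodule.span_mono (Set.range_comp_subset_range _ _)) ?_
  rw [Submodule.span_le]
  have hi : m i ∈ Submodule.span A (Set.range (m ∘ i.succAbove)) := by
    -- In degree `n i` the coordinate at `i` is the constant term of `v i`, a nonzero scalar.
    -- Dividing by it expresses `m i` through the other rows, against minimality.
    have hu := isHomogeneousSubmodule_ker_rowMap (𝒜 := 𝒜) (t := fun _ => 1) hm v hv (n i)
    set u := vecProj 𝒜 n (n i) v with hudef
    have hui : u i = intProj 𝒜 0 (v i) := by simp [hudef]
    obtain ⟨c, hc⟩ := hG.exists_algebraMap (intProj_mem 𝒜 0 (v i))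
    have hc0 : c ≠ 0 := by
      rintro rfl
      exact hvi (by rw [← hc, map_zero])
    have hsum : ∑ k, u k • m k = 0 := by
      rw [LinearMap.mem_ker, rowMap, Fintype.linearCombination_apply] at hu
      exact hu
    rw [Fin.sum_univ_succAbove _ i, hui, ← hc, algebraMap_smul] at hsum
    have : m i = -(c⁻¹ • ∑ k, u (i.succAbove k) • m (i.succAbove k)) := by
      rw [← eq_neg_iff_add_eq_zero] at hsum
      rw [← smul_neg, ← hsum, smul_smul, inv_mul_cancel₀ hc0, one_smul]
    rw [this]
    refine Submodule.neg_mem _ (Submodule.smul_of_tower_mem _ _ (Submodule.sum_mem _ fun k _ =>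
      Submodule.smul_mem _ _ (Submodule.subset_span ⟨k, rfl⟩)))
  rintro _ ⟨k, rfl⟩
  rcases eq_or_ne k i with rfl | hk
  · exact hi
  · obtain ⟨k', rfl⟩ := Fin.exists_succAbove_eq hk
    exact Submodule.subset_span ⟨k', rfl⟩

end Relations

/-! ### The last syzygy and the square matrix of relations. -/

section TopSyzygy

variable {K : Type v} [Field K] {A : Type u} [Ring A] [Algebra K A]
  {𝒜 : ℕ → Submodule K A} [GradedAlgebra 𝒜]

lemma intProj_mul (a : A) : ∃ t : Finset ℤ, ∀ k b,
    intProj 𝒜 k (a * b) = ∑ i ∈ t, intProj 𝒜 i a * intProj 𝒜 (k - i) b := by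
  obtain ⟨t, ht⟩ := exists_sum_intProj 𝒜 a
  refine ⟨t, fun k b => ?_⟩
  conv_lhs => rw [← ht t subset_rfl, Finset.sum_mul, map_sum]
  exact Finset.sum_congr rfl fun i _ => intProj_mul_of_mem_left (intProj_mem 𝒜 i a) k b

/-- An element with invertible constant term is right regular. -/
lemma eq_zero_of_mul_eq_zero {c : K} (hc : c ≠ 0) {p a : A} (hp : p - algebraMap K A c ∈ augIdeal 𝒜)
    (h : a * p = 0) : a = 0 := by
  have ha : a = -(c⁻¹ • (a * (p - algebraMap K A c))) := by
    rw [mul_sub, h, zero_sub, smul_neg, neg_neg, ← Algebra.commutes, ← Algebra.smul_def, smul_smul,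
      inv_mul_cancel₀ hc, one_smul]
  -- By `ha`, a component of `a` is a combination of products of strictly lower components of `a`
  -- with components of positive degree.
  have key : ∀ n : ℕ, ∀ k : ℤ, k < n → intProj 𝒜 k a = 0 := by
    intro n
    induction n with
    | zero => exact fun k hk => intProj_of_neg 𝒜 (by exact_mod_cast hk) a
    | succ n ih =>
      intro k hk
      obtain ⟨t, ht⟩ := intProj_mul (𝒜 := 𝒜) a
      rw [ha, map_neg, map_smul, ht, Finset.sum_eq_zero, smul_zero, neg_zero]
      intro i _
      rcases lt_or_ge i n with hi | hi
      · rw [ih i hi, zero_mul]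
      · rw [intProj_of_mem_augIdeal hp (by push_cast at hk; omega), mul_zero]
  exact eq_zero_of_intProj 𝒜 fun k => key (k.toNat + 1) k (by omega)

variable {r : ℕ}

/-- Scalar-valued functionals on a projective module lift to `A`-valued ones. -/
lemma IsGrAlg.exists_lift_functional (hG : IsGrAlg 𝒜) {Z : Submodule A (Fin r → A)}
    [Module.Projective A Z] (l : (Fin r → A) →ₗ[K] K) (hl : ∀ x ∈ augIdeal 𝒜 • Z, l x = 0) :
    ∃ ψ : Z →ₗ[A] A, ∀ x : Z, ψ x - algebraMap K A (l x) ∈ augIdeal 𝒜 := by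
  -- As `l` kills `augIdeal 𝒜 • Z`, it is `A`-linear into the trivial module.
  let ℓ : Z →ₗ[A] A ⧸ augIdeal 𝒜 :=
    { toFun := fun x => (augIdeal 𝒜).mkQ (algebraMap K A (l x))
      map_add' := fun x x' => by simp
      map_smul' := fun a x => by
        obtain ⟨c, hc⟩ := hG.exists_sub_mem_augIdeal a
        have h1 := hl _ (Submodule.smul_mem_smul hc x.2)
        rw [sub_smul, map_sub, sub_eq_zero, algebraMap_smul,
          LinearMap.map_smul l c] at h1
        rw [RingHom.id_apply, ← map_smul, Submodule.coe_smul, h1, ← sub_eq_zero, ← map_sub,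
          Submodule.mkQ_apply, Submodule.Quotient.mk_eq_zero, smul_eq_mul, smul_eq_mul, map_mul,
          ← sub_mul]
        have := Ideal.mul_mem_left (augIdeal 𝒜) (algebraMap K A (l x)) hc
        rw [Algebra.commutes, sub_mul] at this
        rw [sub_mul]
        rw [← neg_mem_iff, neg_sub]
        exact this }
  obtain ⟨ψ, hψ⟩ := Module.projective_lifting_property (augIdeal 𝒜).mkQ ℓ
    (Submodule.mkQ_surjective _)
  refine ⟨ψ, fun x => ?_⟩
  have := LinearMap.congr_fun hψ x
  rw [LinearMap.comp_apply] at this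
  change (augIdeal 𝒜).mkQ (ψ x) = (augIdeal 𝒜).mkQ (algebraMap K A (l x)) at this
  rwa [← sub_eq_zero, ← map_sub, Submodule.mkQ_apply, Submodule.Quotient.mk_eq_zero] at this

lemma exists_functional {W : Submodule A (Fin r → A)} {z : Fin r → A} (hz : z ∉ W) :
    ∃ l : (Fin r → A) →ₗ[K] K, l z ≠ 0 ∧ ∀ x ∈ W, l x = 0 := by
  obtain ⟨l, hl, hW⟩ := Submodule.exists_le_ker_of_notMem (p := W.restrictScalars K) (v := z)
    (by simpa using hz)
  exact ⟨l, hl, fun x hx => hW (by simpa using hx)⟩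

variable {g : ℕ} (y : Module.Basis (Fin g) K (𝒜 1))

/-- For a regular algebra of global dimension `3`, the last syzygy of the trivial module is free on
a homogeneous generator. -/
lemma IsRegularAlgebra.exists_top_generator (hA : IsRegularAlgebra 𝒜 3)
    {n : Fin r → ℤ} {m : Fin r → Fin g → A} (hn : ∀ i, 2 ≤ n i)
    (hm : ∀ i j, m i j ∈ intPart 𝒜 (n i - 1))
    (hspan : Submodule.span A (Set.range m) = LinearMap.ker (genMap y))
    (hmin : ∀ v ∈ LinearMap.ker (rowMap m), ∀ i, v i ∈ augIdeal 𝒜) :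
    ∃ (d : ℤ) (z : Fin r → A), (∀ i, z i ∈ intPart 𝒜 (d - n i)) ∧
      LinearMap.ker (rowMap m) = Submodule.span A {z} ∧ ∀ a : A, a • z = 0 → a = 0 := by
  have hG := hA.grAlg
  have hproj := hA.projective_ker_rowMap y hspan
  obtain ⟨θ, hθs, hθm, hθe⟩ := hA.exists_dual_ker y hspan
  have hZ : IsHomogeneousSubmodule 𝒜 n (LinearMap.ker (rowMap m)) :=
    isHomogeneousSubmodule_ker_rowMap (t := fun _ => 1) hm
  generalize LinearMap.ker (rowMap m) = Z at hproj θ hθs hθm hθe hZ hmin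
  -- A form killed by `θ` comes from `A^r`, and by minimality all entries of vectors in `Z` lie in
  -- the augmentation ideal.
  have hθaug : ∀ h, θ h = 0 → ∀ x : Z, h x ∈ augIdeal 𝒜 := fun h hh x => by
    obtain ⟨t, ht⟩ := hθe h hh
    rw [ht]
    exact Ideal.sum_mem _ fun i _ => Ideal.mul_mem_right _ _ (hmin x x.2 i)
  have hnon := hG.nontrivial
  obtain ⟨v, hvZ, hv⟩ : ∃ v ∈ Z, v ∉ augIdeal 𝒜 • Z := by
    by_contra! hcon
    have h0 : Z ≤ ⊥ := le_of_le_sup_augIdeal_smul (fun i => by have := hn i; omega)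
      (isHomogeneousSubmodule_bot (𝒜 := 𝒜) n) (by rw [bot_sup_eq]; exact hcon)
    obtain ⟨h, hh⟩ := hθs ⟨1, SetLike.one_mem_graded 𝒜⟩
    have : h = 0 := by
      ext x
      have : x = 0 := Subtype.ext (by simpa using h0 x.2)
      rw [this, map_zero, map_zero]
    rw [this, map_zero] at hh
    exact one_ne_zero (congrArg Subtype.val hh).symm
  obtain ⟨d, hd⟩ : ∃ d, vecProj 𝒜 n d v ∉ augIdeal 𝒜 • Z := by
    by_contra! hcon
    obtain ⟨t, ht⟩ := exists_sum_vecProj 𝒜 n v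
    exact hv (ht ▸ Submodule.sum_mem _ fun k _ => hcon k)
  have hzZ := hZ v hvZ d
  have hzd : ∀ i, vecProj 𝒜 n d v i ∈ intPart 𝒜 (d - n i) := fun i => intProj_mem 𝒜 _ _
  generalize vecProj 𝒜 n d v = z at hd hzZ hzd
  obtain ⟨l, hlz, hl⟩ := exists_functional (K := K) hd
  obtain ⟨ψ, hψ⟩ := hG.exists_lift_functional l hl
  -- The quotient of `Z` by `augIdeal 𝒜 • Z` is a line. Otherwise there are functionals `l`, `l'`
  -- with `l z ≠ 0`, `l' z = 0` and `l' ≠ 0` on `Z`. The values of `θ` at their lifts lie in a line,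
  -- so `θ` kills `ψ - ψ' s` for a scalar `s`; evaluation at `z` then forces `l z = 0`.
  have hle : Z ≤ Submodule.span A {z} ⊔ augIdeal 𝒜 • Z := by
    intro z' hz'
    by_contra hcon
    obtain ⟨l', hlz', hl'⟩ := exists_functional (K := K) hcon
    obtain ⟨ψ', hψ'⟩ := hG.exists_lift_functional l' fun x hx => hl' x (Submodule.mem_sup_right hx)
    have h1 : θ ψ' ≠ 0 := fun h0 => hlz' <| hG.eq_zero_of_mem_augIdeal <| by
      have := sub_mem (hθaug ψ' h0 ⟨z', hz'⟩) (hψ' ⟨z', hz'⟩)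
      simpa using this
    obtain ⟨c, hc⟩ := hG.exists_algebraMap (a := (θ ψ' : A)) (by
      rw [intPart_zero_eq]; exact SetLike.coe_mem _)
    obtain ⟨e, he⟩ := hG.exists_algebraMap (a := (θ ψ : A)) (by
      rw [intPart_zero_eq]; exact SetLike.coe_mem _)
    have hc0 : c ≠ 0 := by
      rintro rfl
      exact h1 (Subtype.ext (by rw [← hc, map_zero]; rfl))
    set s : A := algebraMap K A (c⁻¹ * e) with hs
    have hs0 : ((GradedRing.projZeroRingHom' 𝒜 s : 𝒜 0) : A) = s := by
      change ((DirectSum.decompose 𝒜 s 0 : 𝒜 0) : A) = s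
      rw [← intProj_natCast]
      exact intProj_of_mem (algebraMap_mem_intPart_zero _)
    have h2 : θ (ψ - LinearMap.toSpanSingleton A A s ∘ₗ ψ') = 0 := by
      rw [map_sub, hθm, sub_eq_zero]
      apply Subtype.ext
      rw [SetLike.GradeZero.coe_mul, hs0, ← hc, ← he, hs, ← map_mul, mul_inv_cancel_left₀ hc0]
    have h3 := hθaug _ h2 ⟨z, hzZ⟩
    have h4 : ψ' ⟨z, hzZ⟩ ∈ augIdeal 𝒜 := by
      have := hψ' ⟨z, hzZ⟩
      rwa [hl' z (Submodule.mem_sup_left (Submodule.mem_span_singleton_self z)), map_zero,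
        sub_zero] at this
    refine hlz (hG.eq_zero_of_mem_augIdeal ?_)
    have h5 : ψ ⟨z, hzZ⟩ ∈ augIdeal 𝒜 := by
      have := add_mem h3 (Ideal.mul_mem_right s (augIdeal 𝒜) h4)
      simpa using this
    have := sub_mem h5 (hψ ⟨z, hzZ⟩)
    simpa using this
  refine ⟨d, z, hzd, le_antisymm ?_ ?_, fun a ha => ?_⟩
  · exact le_of_le_sup_augIdeal_smul (fun i => by have := hn i; omega)
      (isHomogeneousSubmodule_span_singleton hzd) hle
  · rw [Submodule.span_le, Set.singleton_subset_iff]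
    exact hzZ
  -- Freeness: `ψ z` has the nonzero constant term `l z`, and `a • z = 0` gives `a * ψ z = 0`.
  · refine eq_zero_of_mul_eq_zero hlz (hψ ⟨z, hzZ⟩) ?_
    rw [← smul_eq_mul, ← map_smul]
    have : a • (⟨z, hzZ⟩ : Z) = 0 := Subtype.ext ha
    rw [this, map_zero]

/-- The entries of the generator of the last syzygy generate the augmentation ideal on the right. -/
lemma IsRegularAlgebra.exists_right_combination (hA : IsRegularAlgebra 𝒜 3)
    {m : Fin r → Fin g → A}
    (hspan : Submodule.span A (Set.range m) = LinearMap.ker (genMap y))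
    {z : Fin r → A} (hz : LinearMap.ker (rowMap m) = Submodule.span A {z})
    (hfree : ∀ a : A, a • z = 0 → a = 0) {a : A} (ha : a ∈ augIdeal 𝒜) :
    ∃ t : Fin r → A, a = ∑ i, z i * t i := by
  have hdual := hA.exists_dual_ker y hspan
  rw [hz] at hdual
  obtain ⟨θ, -, hθm, hθe⟩ := hdual
  let e : A ≃ₗ[A] Submodule.span A {z} := LinearEquiv.ofBijective
    ((LinearMap.toSpanSingleton A (Fin r → A) z).codRestrict _ fun b =>
      Submodule.mem_span_singleton.2 ⟨b, rfl⟩)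
    ⟨by
      rw [injective_iff_map_eq_zero]
      exact fun b hb => hfree b (congrArg Subtype.val hb),
     fun ⟨x, hx⟩ => by
      obtain ⟨b, hb⟩ := Submodule.mem_span_singleton.1 hx
      exact ⟨b, Subtype.ext hb⟩⟩
  -- The form sending `z` to `a` is the dual generator times `a`, and the augmentation ideal acts by
  -- zero on `Ext^3(K, A)`.
  have h0 : θ (LinearMap.toSpanSingleton A A a ∘ₗ e.symm.toLinearMap) = 0 := by
    rw [hθm]
    have : GradedRing.projZeroRingHom' 𝒜 a = 0 := by
      apply Subtype.ext
      change ((DirectSum.decompose 𝒜 a 0 : 𝒜 0) : A) = 0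
      rw [← intProj_natCast]
      exact mem_augIdeal.1 ha
    rw [this, mul_zero]
  obtain ⟨t, ht⟩ := hθe _ h0
  refine ⟨t, ?_⟩
  have h1 : e.symm ⟨z, Submodule.mem_span_singleton_self z⟩ = 1 := by
    rw [LinearEquiv.symm_apply_eq]
    exact Subtype.ext (one_smul A z).symm
  have := ht ⟨z, Submodule.mem_span_singleton_self z⟩
  rw [← this, LinearMap.comp_apply, LinearEquiv.coe_coe, h1]
  simp

/-- The entries of the generator of the last syzygy are linearly independent modulo decomposable
elements. -/
lemma IsRegularAlgebra.eq_zero_of_combination (hA : IsRegularAlgebra 𝒜 3)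
    {n : Fin r → ℤ} {m : Fin r → Fin g → A} (hn : ∀ i, 2 ≤ n i)
    (hm : ∀ i j, m i j ∈ intPart 𝒜 (n i - 1))
    (hspan : Submodule.span A (Set.range m) = LinearMap.ker (genMap y))
    {z : Fin r → A} (hz : LinearMap.ker (rowMap m) = Submodule.span A {z})
    (c : Fin r → K) (b : Fin r → A) (hb : ∀ i, b i ∈ augIdeal 𝒜)
    (h : ∑ i, c i • z i = ∑ i, z i * b i) : c = 0 := by
  have h0 : ∑ i, z i * (algebraMap K A (c i) - b i) = 0 := by
    simp only [mul_sub, Finset.sum_sub_distrib]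
    rw [← h, sub_eq_zero]
    exact Finset.sum_congr rfl fun i _ => by rw [← Algebra.commutes, Algebra.smul_def]
  obtain ⟨e, he⟩ := hA.exists_row_factor y hspan (fun i => algebraMap K A (c i) - b i) (by
    intro u hu
    have hu : u ∈ LinearMap.ker (rowMap m) := hu
    rw [hz] at hu
    obtain ⟨a, rfl⟩ := Submodule.mem_span_singleton.1 hu
    simp only [Pi.smul_apply, smul_eq_mul, mul_assoc]
    rw [← Finset.mul_sum, h0, mul_zero])
  funext i
  refine hA.grAlg.eq_zero_of_mem_augIdeal ?_
  have : algebraMap K A (c i) - b i ∈ augIdeal 𝒜 := by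
    rw [he]
    exact Ideal.sum_mem _ fun j _ => Ideal.mul_mem_right _ _
      (mem_augIdeal_of_mem_intPart (hm i j) (by have := hn i; omega))
  simpa using add_mem this (hb i)

/-- A `g × g` matrix `m` with entries of degree `p` whose rows are independent and generate the
relations between the generators on the right of the entries, and whose columns are relations with
the generators on the left. -/
structure IsRelationMatrix (y : Module.Basis (Fin g) K (𝒜 1)) (p : ℕ) (m : Fin g → Fin g → A) :
    Prop where
  mem : ∀ i j, m i j ∈ 𝒜 p
  span_eq : Submodule.span A (Set.range m) = LinearMap.ker (genMap y)
  left_rel : ∀ j, ∑ i, (y i : A) * m i j = 0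
  indep : ∀ c : Fin g → K, (∀ j, ∑ i, c i • m i j = 0) → c = 0

/-- The entries of `z` form a basis of `A_1`, so the base change from `z` to `y`, applied to the
rows of `m`, turns the syzygy `z m = 0` into `y m' = 0`. The equality `r = g` is implicit in the two
bases. -/
theorem IsRegularAlgebra.exists_relation_matrix (hA : IsRegularAlgebra 𝒜 3) :
    ∃ p : ℕ, 1 ≤ p ∧ ∃ m : Fin g → Fin g → A, IsRelationMatrix y p m := by
  have hG := hA.grAlg
  obtain ⟨r, n, m, hn, hm, hspan, hmin⟩ := hG.exists_minimal_relations y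
  obtain ⟨d, z, hzd, hz, hfree⟩ := hA.exists_top_generator y hn hm hspan hmin
  have hzZ : z ∈ LinearMap.ker (rowMap m) := by
    rw [hz]
    exact Submodule.mem_span_singleton_self z
  have hzaug := hmin z hzZ
  have hcomb := fun {a} => hA.exists_right_combination y hspan hz hfree (a := a)
  have hindep := hA.eq_zero_of_combination y hn hm hspan hz
  have hnon := hG.nontrivial
  have hdeg : ∀ i, d - n i = 1 := by
    intro i
    by_contra hi
    choose t ht using fun j : Fin g => hcomb (mem_augIdeal_of_mem_intPart (basis_mem_intPart y j)
      one_ne_zero)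
    -- An entry of degree other than `1` would be decomposable: it is zero in degree at most `0` (by
    -- minimality in degree `0`). Writing the `y j` through `z` then contradicts `hindep`.
    obtain ⟨b, hb, hzb⟩ : ∃ b : Fin g → A, (∀ j, b j ∈ augIdeal 𝒜) ∧
        z i = ∑ j, (y j : A) * b j := by
      rcases eq_or_ne (d - n i) 0 with h0 | h0
      · refine ⟨0, fun _ => zero_mem _, ?_⟩
        have h1 := hzd i
        rw [h0] at h1
        rw [← intProj_of_mem h1, mem_augIdeal.1 (hzaug i)]
        simp
      · obtain ⟨b, hb, h⟩ := hG.exists_sum_basis_mul y h0 (hzd i)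
        exact ⟨b, fun j => mem_augIdeal_of_mem_intPart (hb j) (by omega), h⟩
    have h1 := hindep (Pi.single i 1) (fun k => ∑ j, t j k * b j)
      (fun k => Ideal.sum_mem _ fun j _ => Ideal.mul_mem_left _ _ (hb j)) (by
        rw [Finset.sum_eq_single i (fun k _ hk => by rw [Pi.single_eq_of_ne hk, zero_smul])
          (by simp), Pi.single_eq_same, one_smul, hzb]
        simp only [Finset.mul_sum]
        rw [Finset.sum_comm]
        refine Finset.sum_congr rfl fun j _ => ?_
        conv_lhs => rw [ht j, Finset.sum_mul]
        exact Finset.sum_congr rfl fun k _ => mul_assoc _ _ _)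
    have := congrFun h1 i
    simp at this
  have hz1 : ∀ i, z i ∈ 𝒜 1 := fun i => by
    rw [← intPart_one_eq (𝒜 := 𝒜), ← hdeg i]
    exact hzd i
  let zE : Module.Basis (Fin r) K (𝒜 1) := Module.Basis.mk (v := fun i => ⟨z i, hz1 i⟩)
    (by
      rw [Fintype.linearIndependent_iff]
      intro c hc
      refine congrFun (hindep c 0 (fun _ => zero_mem _) ?_)
      have := congrArg (Submodule.subtype _) hc
      simpa using this)
    (by
      rintro ⟨x, hx⟩ -
      have hx1 : x ∈ intPart 𝒜 1 := by rwa [intPart_one_eq]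
      obtain ⟨t, ht⟩ := hcomb (mem_augIdeal_of_mem_intPart hx1 one_ne_zero)
      choose c hc using fun i => hG.exists_algebraMap (intProj_mem 𝒜 0 (t i))
      have hx2 : x = ∑ i, c i • z i := by
        rw [← intProj_of_mem hx1, ht, map_sum]
        refine Finset.sum_congr rfl fun i _ => ?_
        rw [intProj_mul_of_mem_left (i := 1) (by rw [intPart_one_eq]; exact hz1 i), sub_self, ← hc,
          ← Algebra.commutes, Algebra.smul_def]
      have hx3 : (⟨x, hx⟩ : 𝒜 1) = ∑ i, c i • ⟨z i, hz1 i⟩ := Subtype.ext (by simpa using hx2)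
      rw [hx3]
      exact Submodule.sum_mem _ fun i _ => Submodule.smul_mem _ _
        (Submodule.subset_span ⟨i, rfl⟩))
  have hzE : ∀ i, (zE i : A) = z i := fun i => by simp [zE]
  -- With `r = 0` the vector `z` would be zero and could not be free.
  obtain ⟨i₀⟩ : Nonempty (Fin r) := by
    by_contra hr
    rw [not_nonempty_iff] at hr
    exact one_ne_zero (hfree 1 (Subsingleton.elim _ _))
  obtain ⟨p, hp⟩ : ∃ p : ℕ, d = p + 2 := ⟨(d - 2).toNat, by
    have := hdeg i₀; have := hn i₀; omega⟩
  let P := y.toMatrix zE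
  let Q := zE.toMatrix y
  have hQP : Q * P = 1 := zE.toMatrix_mul_toMatrix_flip y
  let m' : Fin g → Fin g → A := fun k j => ∑ i, P k i • m i j
  have hm'eq : ∀ k, m' k = ∑ i, P k i • m i := fun k => by
    ext j
    simp [m']
  refine ⟨p, ?_, m', ?_, ?_, ?_, ?_⟩
  · have := hdeg i₀; have := hn i₀; omega
  · intro k j
    refine Submodule.sum_mem _ fun i _ => Submodule.smul_mem _ _ ?_
    rw [← intPart_natCast 𝒜]
    convert hm i j using 2
    have := hdeg i
    omega
  · rw [← hspan]
    refine le_antisymm ?_ ?_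
    · rw [Submodule.span_le]
      rintro _ ⟨k, rfl⟩
      rw [hm'eq]
      exact Submodule.sum_mem _ fun i _ => Submodule.smul_of_tower_mem _ _
        (Submodule.subset_span ⟨i, rfl⟩)
    · rw [Submodule.span_le]
      rintro _ ⟨i, rfl⟩
      have : m i = ∑ k, Q i k • m' k := by
        simp only [hm'eq, Finset.smul_sum, smul_smul]
        rw [Finset.sum_comm]
        simp only [← Finset.sum_smul]
        have h1 : ∀ i', ∑ k, Q i k * P k i' = if i = i' then 1 else 0 := fun i' => by
          rw [← Matrix.mul_apply, hQP, Matrix.one_apply]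
        simp [h1]
      rw [this]
      exact Submodule.sum_mem _ fun k _ => Submodule.smul_of_tower_mem _ _
        (Submodule.subset_span ⟨k, rfl⟩)
  · intro j
    have h1 : ∀ i, z i = ∑ k, P k i • (y k : A) := fun i => by
      have := congrArg (Submodule.subtype _) (y.sum_repr (zE i))
      simp only [map_sum, map_smul, Submodule.subtype_apply, hzE] at this
      exact this.symm
    have h2 := congrFun (LinearMap.mem_ker.1 hzZ) j
    rw [rowMap_apply, Pi.zero_apply] at h2
    rw [← h2]
    simp only [m', Finset.mul_sum]
    rw [Finset.sum_comm]
    refine Finset.sum_congr rfl fun i _ => ?_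
    rw [h1, Finset.sum_mul]
    exact Finset.sum_congr rfl fun k _ => by rw [mul_smul_comm, smul_mul_assoc]
  · intro c hc
    have h1 : (fun i => algebraMap K A (∑ k, c k * P k i)) ∈ LinearMap.ker (rowMap m) := by
      rw [LinearMap.mem_ker]
      ext j
      rw [rowMap_apply, Pi.zero_apply, ← hc j]
      simp only [← Algebra.smul_def, m', Finset.smul_sum, Finset.sum_smul, smul_smul]
      exact Finset.sum_comm
    have h2 : ∀ i, ∑ k, c k * P k i = 0 := fun i => hG.eq_zero_of_mem_augIdeal (hmin _ h1 i)
    have hPQ : P * Q = 1 := y.toMatrix_mul_toMatrix_flip zE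
    have h3 : Matrix.vecMul c P = 0 := funext h2
    rw [← Matrix.vecMul_one c, ← hPQ, ← Matrix.vecMul_vecMul, h3, Matrix.zero_vecMul]

end TopSyzygy

/-! ### Evaluation of homogeneous noncommutative polynomials. -/

section Words

variable {K : Type v} [Field K] {g : ℕ} {B : Type*} [Ring B] [Algebra K B]

/-- The value at `x` of the homogeneous noncommutative polynomial of degree `n` with
coefficients `T`. -/
def wordEval (x : Fin g → B) (n : ℕ) : ((Fin n → Fin g) → K) →ₗ[K] B :=
  Fintype.linearCombination K fun f => (List.ofFn fun i => x (f i)).prod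

lemma wordEval_apply (x : Fin g → B) (n : ℕ) (T : (Fin n → Fin g) → K) :
    wordEval x n T = ∑ f, T f • (List.ofFn fun i => x (f i)).prod := by
  simp [wordEval, Fintype.linearCombination_apply]

lemma sum_fin_cons {M : Type*} [AddCommMonoid M] {n : ℕ} (F : (Fin (n + 1) → Fin g) → M) :
    ∑ f, F f = ∑ i, ∑ f : Fin n → Fin g, F (Fin.cons i f) := by
  rw [← Fintype.sum_prod_type', ← (Fin.consEquiv fun _ => Fin g).sum_comp]
  rfl

lemma sum_fin_snoc {M : Type*} [AddCommMonoid M] {n : ℕ} (F : (Fin (n + 1) → Fin g) → M) :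
    ∑ f, F f = ∑ i, ∑ f : Fin n → Fin g, F (Fin.snoc (α := fun _ => Fin g) f i) := by
  rw [← Fintype.sum_prod_type', ← (Fin.snocEquiv fun _ => Fin g).sum_comp]
  rfl

lemma wordEval_zero (x : Fin g → B) (T : (Fin 0 → Fin g) → K) :
    wordEval x 0 T = algebraMap K B (T Fin.elim0) := by
  rw [wordEval_apply, Fintype.sum_unique, Algebra.algebraMap_eq_smul_one, List.ofFn_zero,
    List.prod_nil]
  congr 2

lemma wordEval_cons (x : Fin g → B) (n : ℕ) (T : (Fin (n + 1) → Fin g) → K) :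
    wordEval x (n + 1) T = ∑ i, x i * wordEval x n fun f => T (Fin.cons i f) := by
  simp only [wordEval_apply]
  rw [sum_fin_cons]
  refine Finset.sum_congr rfl fun i _ => ?_
  rw [Finset.mul_sum]
  refine Finset.sum_congr rfl fun f _ => ?_
  rw [List.ofFn_succ, List.prod_cons, mul_smul_comm]
  simp

lemma wordEval_snoc (x : Fin g → B) (n : ℕ) (T : (Fin (n + 1) → Fin g) → K) :
    wordEval x (n + 1) T =
      ∑ i, wordEval x n (fun f => T (Fin.snoc (α := fun _ => Fin g) f i)) * x i := by
  simp only [wordEval_apply]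
  rw [sum_fin_snoc]
  refine Finset.sum_congr rfl fun i _ => ?_
  rw [Finset.sum_mul]
  refine Finset.sum_congr rfl fun f _ => ?_
  rw [List.ofFn_succ', List.concat_eq_append, List.prod_append, List.prod_singleton, smul_mul_assoc]
  simp

lemma exists_sum_mul_of_mem_mul_span (x : Fin g → B) {S : Submodule K B} {a : B}
    (ha : a ∈ S * Submodule.span K (Set.range x)) :
    ∃ c : Fin g → B, (∀ j, c j ∈ S) ∧ a = ∑ j, c j * x j := by
  induction ha using Submodule.mul_induction_on' with
  | mem_mul_mem s hs t ht =>
    obtain ⟨d, rfl⟩ := (Submodule.mem_span_range_iff_exists_fun K).1 ht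
    exact ⟨fun j => d j • s, fun j => S.smul_mem _ hs, by simp [Finset.mul_sum]⟩
  | add a _ b _ hc hd =>
    obtain ⟨c, hc, rfl⟩ := hc
    obtain ⟨d, hd, rfl⟩ := hd
    exact ⟨c + d, fun j => S.add_mem (hc j) (hd j), by simp [add_mul, Finset.sum_add_distrib]⟩

lemma range_wordEval (x : Fin g → B) (n : ℕ) :
    LinearMap.range (wordEval (K := K) x n) = Submodule.span K (Set.range x) ^ n := by
  induction n with
  | zero =>
    refine le_antisymm ?_ ?_
    · rintro _ ⟨T, rfl⟩
      rw [wordEval_zero, pow_zero]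
      exact Submodule.algebraMap_mem _
    · rw [pow_zero, Submodule.one_le]
      exact ⟨fun _ => 1, by rw [wordEval_zero, map_one]⟩
  | succ n ih =>
    refine le_antisymm ?_ fun a ha => ?_
    · rintro _ ⟨T, rfl⟩
      rw [wordEval_snoc, pow_succ, ← ih]
      exact Submodule.sum_mem _ fun i _ => Submodule.mul_mem_mul (LinearMap.mem_range_self _ _)
        (Submodule.subset_span ⟨i, rfl⟩)
    · rw [pow_succ, ← ih] at ha
      obtain ⟨c, hc, rfl⟩ := exists_sum_mul_of_mem_mul_span x ha
      choose T hT using hc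
      refine ⟨fun f => T (f (Fin.last n)) (Fin.init f), ?_⟩
      rw [wordEval_snoc]
      refine Finset.sum_congr rfl fun i _ => ?_
      rw [← hT]
      simp

lemma map_wordEval {B' : Type*} [Ring B'] [Algebra K B'] (φ : B →ₐ[K] B') (x : Fin g → B) (n : ℕ)
    (T : (Fin n → Fin g) → K) : φ (wordEval x n T) = wordEval (fun i => φ (x i)) n T := by
  simp only [wordEval_apply, map_sum, map_smul, map_list_prod, List.map_ofFn]
  rfl

end Words

/-! ### Multilinear forms given by their coefficients. -/

section CoefficientForm

variable {K : Type v} [Field K] {g n : ℕ}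

/-- The multilinear form on `K^g` with given coefficients in the canonical basis. -/
def coeffForm (W : (Fin n → Fin g) → K) : MultilinearMap K (fun _ : Fin n => Fin g → K) K :=
  ∑ F, W F • (MultilinearMap.mkPiAlgebra K (Fin n) K).compLinearMap fun i => LinearMap.proj (F i)

lemma coeffForm_apply (W : (Fin n → Fin g) → K) (X : Fin n → Fin g → K) :
    coeffForm W X = ∑ F, W F * ∏ i, X i (F i) := by
  simp [coeffForm]

lemma coeffForm_cons (W : (Fin (n + 1) → Fin g) → K) (v : Fin g → K) (X : Fin n → Fin g → K) :
    coeffForm W (Fin.cons v X) = ∑ i, v i * coeffForm (fun F => W (Fin.cons i F)) X := by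
  simp only [coeffForm_apply]
  rw [sum_fin_cons]
  refine Finset.sum_congr rfl fun i _ => ?_
  rw [Finset.mul_sum]
  refine Finset.sum_congr rfl fun F _ => ?_
  rw [Fin.prod_univ_succ]
  simp only [Fin.cons_zero, Fin.cons_succ]
  ring

lemma coeffForm_snoc (W : (Fin (n + 1) → Fin g) → K) (v : Fin g → K) (X : Fin n → Fin g → K) :
    coeffForm W (Fin.snoc (α := fun _ => Fin g → K) X v) =
      ∑ i, v i * coeffForm (fun F => W (Fin.snoc (α := fun _ => Fin g) F i)) X := by
  simp only [coeffForm_apply]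
  rw [sum_fin_snoc]
  refine Finset.sum_congr rfl fun i _ => ?_
  rw [Finset.mul_sum]
  refine Finset.sum_congr rfl fun F _ => ?_
  rw [Fin.prod_univ_castSucc]
  simp only [Fin.snoc_last, Fin.snoc_castSucc]
  ring

lemma coeffForm_single (W : (Fin n → Fin g) → K) (F : Fin n → Fin g) :
    coeffForm W (fun i => Pi.single (F i) 1) = W F := by
  classical
  rw [coeffForm_apply, Finset.sum_eq_single F]
  · simp
  · intro G _ hG
    obtain ⟨i, hi⟩ := Function.ne_iff.1 hG
    rw [Finset.prod_eq_zero (Finset.mem_univ i) (Pi.single_eq_of_ne hi 1), mul_zero]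
  · simp

lemma isQCyclic_coeffForm {W : (Fin (n + 1) → Fin g) → K} {C : Matrix (Fin g) (Fin g) K}
    (hC : ∀ F j, W (Fin.snoc (α := fun _ => Fin g) F j) = ∑ i, C j i * W (Fin.cons i F))
    (Q : (Fin g → K) ≃ₗ[K] (Fin g → K)) (hQ : ∀ v i, Q v i = ∑ j, v j * C j i) :
    IsQCyclic (coeffForm W) Q := by
  intro X
  conv_lhs => rw [← Fin.snoc_init_self X]
  rw [coeffForm_snoc, coeffForm_cons]
  simp only [hC, hQ, Finset.sum_mul]
  rw [Finset.sum_comm]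
  refine Finset.sum_congr rfl fun j _ => ?_
  simp only [coeffForm_apply, Finset.sum_mul, Finset.mul_sum]
  rw [Finset.sum_comm]
  refine Finset.sum_congr rfl fun i _ => Finset.sum_congr rfl fun F _ => ?_
  simp only [Fin.init]
  ring

lemma IsQCyclic.snoc {V : Type*} [AddCommGroup V] [Module K V]
    {w : MultilinearMap K (fun _ : Fin (n + 1) => V) K} {Q : V ≃ₗ[K] V} (hw : IsQCyclic w Q)
    (X : Fin n → V) (v : V) :
    w (Fin.snoc (α := fun _ => V) X v) = w (Fin.cons (Q v) X) := by
  rw [hw]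
  simp

end CoefficientForm

/-! ### The coefficients `W_{i μ j}` with first and last index split off. -/

section OuterCoefficients

variable {K : Type*} {g p : ℕ}

/-- The coefficients in degree `p + 2` whose slices in the middle are the `M i j`. -/
def outerCoeffs (M : Fin g → Fin g → (Fin p → Fin g) → K) : (Fin (p + 2) → Fin g) → K :=
  fun F => M (F 0) (F (Fin.last (p + 1))) fun k => F k.castSucc.succ

lemma outerCoeffs_snoc (M : Fin g → Fin g → (Fin p → Fin g) → K) (F : Fin (p + 1) → Fin g)
    (j : Fin g) :
    outerCoeffs M (Fin.snoc (α := fun _ => Fin g) F j) = M (F 0) j (Fin.tail F) := by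
  have h0 : Fin.snoc (α := fun _ => Fin g) F j 0 = F 0 :=
    Fin.snoc_castSucc (α := fun _ => Fin g) j F 0
  rw [outerCoeffs, Fin.snoc_last, h0]
  congr 1
  funext k
  rw [Fin.succ_castSucc, Fin.snoc_castSucc]
  rfl

lemma outerCoeffs_cons (M : Fin g → Fin g → (Fin p → Fin g) → K) (F : Fin (p + 1) → Fin g)
    (i : Fin g) :
    outerCoeffs M (Fin.cons i F) = M i (F (Fin.last p)) (Fin.init F) := by
  rw [outerCoeffs, Fin.cons_zero, ← Fin.succ_last, Fin.cons_succ]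
  congr 1

end OuterCoefficients

/-! ### Three-regularity of the form. -/

section RelationMatrix

variable {K : Type v} [Field K] {A : Type u} [Ring A] [Algebra K A]
  {𝒜 : ℕ → Submodule K A} {g : ℕ} {y : Module.Basis (Fin g) K (𝒜 1)}
  {p : ℕ} {m : Fin g → Fin g → A}

lemma span_range_basis (y : Module.Basis (Fin g) K (𝒜 1)) :
    Submodule.span K (Set.range fun j => (y j : A)) = 𝒜 1 := by
  have := congrArg (Submodule.map (𝒜 1).subtype) y.span_eq
  rw [Submodule.map_span, ← Set.range_comp, Submodule.map_top, Submodule.range_subtype] at this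
  exact this

lemma IsRelationMatrix.row_rel (h : IsRelationMatrix y p m) (i : Fin g) :
    ∑ j, m i j * (y j : A) = 0 := by
  have : m i ∈ LinearMap.ker (genMap y) := h.span_eq ▸ Submodule.subset_span ⟨i, rfl⟩
  rwa [LinearMap.mem_ker, genMap_apply] at this

variable [GradedAlgebra 𝒜]

lemma IsGrAlg.range_wordEval_eq (hG : IsGrAlg 𝒜) (y : Module.Basis (Fin g) K (𝒜 1)) (n : ℕ) :
    LinearMap.range (wordEval (fun j => (y j : A)) n) = 𝒜 n := by
  rw [range_wordEval, span_range_basis, ← hG.part_eq_pow]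

lemma IsGrAlg.wordEval_mem (hG : IsGrAlg 𝒜) (y : Module.Basis (Fin g) K (𝒜 1)) {n : ℕ}
    (T : (Fin n → Fin g) → K) : wordEval (fun j => (y j : A)) n T ∈ intPart 𝒜 n := by
  rw [intPart_natCast, ← hG.range_wordEval_eq y]
  exact LinearMap.mem_range_self _ _

namespace IsRelationMatrix

variable (h : IsRelationMatrix y p m)

include h

/-- Since the entries of `m` have degree `p`, homogeneous relations have homogeneous coefficients of
degree `k - p`; in particular there are none for `k < p`. -/
lemma exists_coeffs {v : Fin g → A} (hv : ∑ j, v j * (y j : A) = 0) {k : ℤ}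
    (hk : ∀ j, v j ∈ intPart 𝒜 k) :
    ∃ b : Fin g → A, (∀ i, b i ∈ intPart 𝒜 (k - p)) ∧ ∀ j, v j = ∑ i, b i * m i j := by
  have hv' : v ∈ LinearMap.ker (genMap y) := by rwa [LinearMap.mem_ker, genMap_apply]
  rw [← h.span_eq, ← Fintype.range_linearCombination A] at hv'
  obtain ⟨b, rfl⟩ := hv'
  refine ⟨fun i => intProj 𝒜 (k - p) (b i), fun i => intProj_mem 𝒜 _ _, fun j => ?_⟩
  rw [← intProj_of_mem (hk j), Fintype.linearCombination_apply, Finset.sum_apply, map_sum]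
  refine Finset.sum_congr rfl fun i _ => ?_
  rw [Pi.smul_apply, smul_eq_mul, intProj_mul_of_mem_right]
  rw [intPart_natCast]
  exact h.mem i j

lemma exists_right_factor (hA : IsRegularAlgebra 𝒜 3) {c : Fin g → A}
    (hc : ∀ i, ∑ j, m i j * c j = 0) : ∃ a, ∀ j, c j = y j * a := by
  refine hA.exists_right_factor y c fun v hv => ?_
  have hv' : v ∈ LinearMap.ker (genMap y) := hv
  rw [← h.span_eq] at hv'
  have hle : Submodule.span A (Set.range m) ≤ LinearMap.ker (Fintype.linearCombination A c) := by
    rw [Submodule.span_le]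
    rintro _ ⟨i, rfl⟩
    simpa [Fintype.linearCombination_apply] using hc i
  simpa [Fintype.linearCombination_apply] using hle hv'

/-- For `g = 0` the element `1`, and for `g = 1` the entry `m 0 0`, is killed on the left by the
augmentation ideal. Hence it vanishes, against nontriviality or independence. -/
lemma two_le (hA : IsRegularAlgebra 𝒜 3) : 2 ≤ g := by
  have hnon := hA.grAlg.nontrivial
  have hreg := fun a => hA.gorenstein.eq_zero_of_augIdeal_mul (a := a)
  by_contra hg
  obtain rfl | rfl : g = 0 ∨ g = 1 := by omega
  · refine one_ne_zero (hreg 1 fun s hs => ?_)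
    obtain ⟨v, rfl⟩ := hA.grAlg.exists_genMap_eq y hs
    simp [genMap_apply]
  · have h0 : m 0 0 = 0 := hreg _ fun s hs => by
      obtain ⟨v, rfl⟩ := hA.grAlg.exists_genMap_eq y hs
      have := h.left_rel 0
      rw [Fin.sum_univ_one] at this
      rw [genMap_apply, Fin.sum_univ_one, mul_assoc, this, mul_zero]
    have := congrFun (h.indep 1 fun j => by
      rw [Subsingleton.elim j 0, Fin.sum_univ_one, h0, smul_zero]) 0
    simp at this

lemma wordEval_injective (hG : IsGrAlg 𝒜) {n : ℕ} (hn : n ≤ p) {T : (Fin n → Fin g) → K}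
    (hT : wordEval (fun j => (y j : A)) n T = 0) : T = 0 := by
  have hnon := hG.nontrivial
  induction n with
  | zero =>
    rw [wordEval_zero, map_eq_zero_iff _ (algebraMap K A).injective] at hT
    funext f
    rw [Subsingleton.elim f Fin.elim0, hT, Pi.zero_apply]
  | succ n ih =>
    rw [wordEval_snoc] at hT
    obtain ⟨b, hb, hbm⟩ := h.exists_coeffs hT fun j => hG.wordEval_mem y _
    have hb0 : ∀ i, b i = 0 := fun i => by
      have := hb i
      rwa [intPart_of_neg 𝒜 (by omega), Submodule.mem_bot] at this
    funext f
    rw [← Fin.snoc_init_self f]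
    refine congrFun (ih (by omega) (T := fun f' => T (Fin.snoc f' (f (Fin.last n)))) ?_) (Fin.init f)
    rw [hbm]
    simp [hb0]

/-- Coefficients of the entries of a relation matrix. -/
lemma exists_entry_coeffs (hG : IsGrAlg 𝒜) : ∃ M : Fin g → Fin g → (Fin p → Fin g) → K,
    ∀ i j, wordEval (fun j => (y j : A)) p (M i j) = m i j := by
  have : ∀ i j, m i j ∈ LinearMap.range (wordEval (K := K) (fun j => (y j : A)) p) := fun i j => by
    rw [hG.range_wordEval_eq y]
    exact h.mem i j
  choose M hM using this
  exact ⟨M, hM⟩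

end IsRelationMatrix

namespace IsRelationMatrix

variable (h : IsRelationMatrix y p m) {M : Fin g → Fin g → (Fin p → Fin g) → K}
  (hM : ∀ i j, wordEval (fun j => (y j : A)) p (M i j) = m i j)

include h hM

/-- Read `y m = 0` as a relation with the generators on the right: its coefficients over the rows of
`m` have degree `0`, so they are scalars. Words of length `p` are independent, so the identity in
`A` is one of coefficients. -/
lemma exists_cyclic_matrix (hG : IsGrAlg 𝒜) : ∃ C : Matrix (Fin g) (Fin g) K, ∀ F j,
    outerCoeffs M (Fin.snoc (α := fun _ => Fin g) F j) =
      ∑ i, C j i * outerCoeffs M (Fin.cons i F) := by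
  have key : ∀ j, ∃ c : Fin g → K, ∀ F,
      outerCoeffs M (Fin.snoc (α := fun _ => Fin g) F j) =
        ∑ i, c i * outerCoeffs M (Fin.cons i F) := by
    intro j
    let T : (Fin (p + 1) → Fin g) → K := fun F => M (F 0) j (Fin.tail F)
    have hT : wordEval (fun j => (y j : A)) (p + 1) T = 0 := by
      rw [wordEval_cons, ← h.left_rel j]
      refine Finset.sum_congr rfl fun i _ => ?_
      rw [← hM]
      simp [T]
    rw [wordEval_snoc] at hT
    obtain ⟨b, hb, hbm⟩ := h.exists_coeffs hT fun j => hG.wordEval_mem y _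
    choose c hc using fun i => hG.exists_algebraMap (a := b i) (by simpa using hb i)
    refine ⟨c, fun F => ?_⟩
    have h0 := h.wordEval_injective hG le_rfl
      (T := (fun f => T (Fin.snoc f (F (Fin.last p)))) - ∑ i, c i • M i (F (Fin.last p))) (by
        rw [map_sub, hbm, map_sum, sub_eq_zero]
        refine Finset.sum_congr rfl fun i _ => ?_
        rw [map_smul, hM, ← hc, Algebra.smul_def])
    have h1 := congrFun h0 (Fin.init F)
    rw [Pi.sub_apply, Pi.zero_apply, sub_eq_zero, Fin.snoc_init_self] at h1
    rw [outerCoeffs_snoc]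
    refine h1.trans ?_
    rw [Finset.sum_apply]
    exact Finset.sum_congr rfl fun i _ => by rw [outerCoeffs_cons]; rfl
  choose C hC using key
  exact ⟨C, fun F j => hC j F⟩

/-- A vector `c` in the left kernel of `C` satisfies `m c = 0`, so `c j = y j * a` by
`exists_right_factor`; a scalar in the augmentation ideal is zero. -/
lemma exists_isQCyclic (hA : IsRegularAlgebra 𝒜 3) :
    ∃ Q, IsQCyclic (coeffForm (outerCoeffs M)) Q := by
  have hG := hA.grAlg
  obtain ⟨C, hC⟩ := h.exists_cyclic_matrix hM hG
  have hinj : Function.Injective C.vecMulLinear := by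
    rw [injective_iff_map_eq_zero]
    intro c hc
    have h1 : ∀ i, ∑ j, c j • M i j = 0 := fun i => by
      funext μ
      have h2 : ∀ j, M i j μ = ∑ k, C j k * outerCoeffs M (Fin.cons k (Fin.cons i μ)) := fun j => by
        rw [← hC, outerCoeffs_snoc, Fin.cons_zero, Fin.tail_cons]
      simp only [Finset.sum_apply, Pi.smul_apply, smul_eq_mul, h2, Finset.mul_sum, Pi.zero_apply]
      rw [Finset.sum_comm]
      refine Finset.sum_eq_zero fun k _ => ?_
      have h3 : ∑ j, c j * C j k = 0 := congrFun hc k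
      simp only [← mul_assoc, ← Finset.sum_mul, h3, zero_mul]
    obtain ⟨a, ha⟩ := h.exists_right_factor hA (c := fun j => algebraMap K A (c j)) fun i => by
      have := congrArg (wordEval (fun j => (y j : A)) p) (h1 i)
      rw [map_sum, map_zero] at this
      rw [← this]
      refine Finset.sum_congr rfl fun j _ => ?_
      rw [map_smul, hM, Algebra.smul_def, Algebra.commutes]
    funext j
    refine hG.eq_zero_of_mem_augIdeal ?_
    rw [ha]
    exact Ideal.mul_mem_right _ _
      (mem_augIdeal_of_mem_intPart (basis_mem_intPart y j) one_ne_zero)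
  exact ⟨LinearEquiv.ofInjectiveEndo C.vecMulLinear hinj,
    isQCyclic_coeffForm hC _ fun v i => rfl⟩

lemma isPreregular (hA : IsRegularAlgebra 𝒜 3) : IsPreregular (coeffForm (outerCoeffs M)) where
  nondegenerate v hv := by
    refine h.indep v fun j => ?_
    have h1 : ∑ i, v i • M i j = 0 := by
      funext μ
      have := hv fun k => Pi.single (Fin.snoc (α := fun _ => Fin g) μ j k) 1
      rw [coeffForm_cons] at this
      simp only [coeffForm_single, outerCoeffs_cons, Fin.snoc_last, Fin.init_snoc] at this
      simpa using this
    have := congrArg (wordEval (fun j => (y j : A)) p) h1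
    simpa [hM] using this
  cyclic := h.exists_isQCyclic hM hA

lemma isThreeRegular (hA : IsRegularAlgebra 𝒜 3) :
    IsThreeRegular (coeffForm (outerCoeffs M)) where
  preregular := h.isPreregular hM hA
  two_site L₀ L₁ hL := by
    obtain ⟨Q, hQ⟩ := h.exists_isQCyclic hM hA
    let e : Fin g → Fin g → K := fun j => Pi.single j 1
    -- Cyclicity moves the first argument to the last place, where `L₀` becomes its conjugate by
    -- `Q`; the hypothesis then compares the two outer indices of `m`.
    let L : Module.End K (Fin g → K) := Q.symm.toLinearMap ∘ₗ L₀ ∘ₗ Q.toLinearMap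
    have hLQ : ∀ v, Q (L v) = L₀ (Q v) := fun v => by simp [L]
    have hcoef : ∀ i j, ∑ k, L (e j) k • M i k = ∑ k, L₁ (e i) k • M k j := by
      intro i j
      funext μ
      let X : Fin (p + 1) → Fin g → K := Fin.cons (e i) fun k => e (μ k)
      have h1 := hL (Fin.cons (Q (e j)) X)
      rw [Fin.cons_zero, Fin.update_cons_zero, ← hLQ, ← hQ.snoc] at h1
      have h2 : Function.update (Fin.cons (Q (e j)) X : Fin (p + 2) → Fin g → K) 1
          (L₁ ((Fin.cons (Q (e j)) X : Fin (p + 2) → Fin g → K) 1)) =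
            Fin.cons (Q (e j)) (Fin.cons (L₁ (e i)) fun k => e (μ k)) := by
        rw [← Fin.succ_zero_eq_one, Fin.cons_succ, ← Fin.cons_update]
        simp only [X, Fin.cons_zero, Fin.update_cons_zero]
      rw [h2, ← hQ.snoc, coeffForm_snoc] at h1
      have h3 : (Fin.snoc (α := fun _ => Fin g → K) (Fin.cons (L₁ (e i)) fun k => e (μ k)) (e j) :
          Fin (p + 2) → Fin g → K) =
          Fin.cons (L₁ (e i)) fun k => e (Fin.snoc (α := fun _ => Fin g) μ j k) := by
        rw [← Fin.cons_snoc_eq_snoc_cons]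
        congr 1
        funext k
        refine Fin.lastCases ?_ (fun k => ?_) k <;> simp
      have h4 : X = fun k => e ((Fin.cons i μ : Fin (p + 1) → Fin g) k) := by
        funext k
        refine Fin.cases ?_ (fun k => ?_) k <;> simp [X]
      rw [h3, coeffForm_cons, h4] at h1
      simp only [e, coeffForm_single, outerCoeffs_snoc, outerCoeffs_cons, Fin.snoc_last,
        Fin.init_snoc, Fin.cons_zero, Fin.tail_cons] at h1
      simpa using h1
    have hent : ∀ i j, ∑ k, L (e j) k • m i k = ∑ k, L₁ (e i) k • m k j := fun i j => by
      have := congrArg (wordEval (fun j => (y j : A)) p) (hcoef i j)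
      simpa [hM] using this
    -- Multiplying `hent` on the right by `y j` and summing over `j` leaves rows of `m y = 0`, so
    -- `m` kills the vector of transformed generators. By degree, only the constant term of `a`
    -- matters.
    obtain ⟨a, ha⟩ := h.exists_right_factor hA (c := fun k => ∑ j, L (e j) k • (y j : A)) fun i => by
      simp only [Finset.mul_sum]
      rw [Finset.sum_comm]
      have h5 : ∀ j, ∑ k, m i k * L (e j) k • (y j : A) = ∑ k, L₁ (e i) k • (m k j * y j) :=
        fun j => by
          simp only [mul_smul_comm, ← smul_mul_assoc, ← Finset.sum_mul, hent]
      simp only [h5]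
      rw [Finset.sum_comm]
      simp only [← Finset.smul_sum, h.row_rel, smul_zero, Finset.sum_const_zero]
    obtain ⟨κ, hκ⟩ := hA.grAlg.exists_algebraMap (intProj_mem 𝒜 0 a)
    have hLe : ∀ j, L (e j) = κ • e j := by
      intro j
      funext k
      have h6 : ∑ j, L (e j) k • y j = κ • y k := by
        apply Subtype.ext
        have h7 : ∑ j, L (e j) k • (y j : A) ∈ intPart 𝒜 1 :=
          Submodule.sum_mem _ fun j _ => Submodule.smul_mem _ _ (basis_mem_intPart y j)
        have h8 : ∑ j, L (e j) k • (y j : A) = κ • (y k : A) := by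
          rw [← intProj_of_mem h7, ha k, intProj_mul_of_mem_left (basis_mem_intPart y k), sub_self,
            ← hκ, ← Algebra.commutes, ← Algebra.smul_def]
        simpa using h8
      have h9 := congrArg (fun x => y.repr x j) h6
      simp only [map_sum, map_smul, Module.Basis.repr_self] at h9
      simpa [Finsupp.single_apply, e, Pi.single_apply, eq_comm] using h9
    have hLκ : ∀ v, L v = κ • v := fun v => by
      have : L = κ • (1 : Module.End K (Fin g → K)) := by
        refine LinearMap.pi_ext' fun j => LinearMap.ext_ring ?_
        simpa [e] using hLe j
      rw [this]
      rfl
    refine ⟨κ, ?_, ?_⟩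
    · refine LinearMap.ext fun v => ?_
      obtain ⟨u, rfl⟩ := Q.surjective v
      rw [← hLQ, hLκ, map_smul]
      rfl
    · refine LinearMap.pi_ext' fun i => LinearMap.ext_ring ?_
      have h10 := h.indep (L₁ (e i) - κ • e i) fun j => by
        simp only [Pi.sub_apply, sub_smul, Finset.sum_sub_distrib]
        rw [← hent, hLe]
        simp [e, Pi.single_apply]
      simpa [e, sub_eq_zero] using h10

end IsRelationMatrix

end RelationMatrix

/-! ### The isomorphism with the algebra of the form. -/

section FormAlgebraIso

variable {K : Type v} [Field K] {g N : ℕ}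

lemma iSup_component (w : MultilinearMap K (fun _ : Fin (N + 1) => Fin g → K) K) :
    ⨆ n, FormAlgebra.component w n = ⊤ := by
  set S := Submodule.span K (Set.range (FormAlgebra.x w)) with hS
  change ⨆ n : ℕ, S ^ n = ⊤
  have hmul : (⨆ n : ℕ, S ^ n) * (⨆ n : ℕ, S ^ n) ≤ ⨆ n : ℕ, S ^ n := by
    rw [Submodule.iSup_mul]
    refine iSup_le fun i => ?_
    rw [Submodule.mul_iSup]
    refine iSup_le fun j => ?_
    rw [← pow_add]
    exact le_iSup (fun n : ℕ => S ^ n) (i + j)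
  rw [eq_top_iff]
  rintro u -
  obtain ⟨t, rfl⟩ := RingQuot.mkAlgHom_surjective K (FormRel w) u
  induction t using FreeAlgebra.induction with
  | grade0 c =>
    rw [AlgHom.commutes]
    refine Submodule.mem_iSup_of_mem 0 ?_
    rw [pow_zero]
    exact Submodule.algebraMap_mem c
  | grade1 l =>
    refine Submodule.mem_iSup_of_mem 1 ?_
    rw [pow_one]
    exact Submodule.subset_span ⟨l, rfl⟩
  | mul a b ha hb =>
    rw [map_mul]
    exact hmul (Submodule.mul_mem_mul ha hb)
  | add a b ha hb =>
    rw [map_add]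
    exact Submodule.add_mem _ ha hb

variable {A : Type u} [Ring A] [Algebra K A] {𝒜 : ℕ → Submodule K A}
  {y : Module.Basis (Fin g) K (𝒜 1)} {p : ℕ} {m : Fin g → Fin g → A}

lemma formRelator_coeffForm {B : Type*} [Ring B] [Algebra K B]
    (M : Fin g → Fin g → (Fin p → Fin g) → K) (φ : FreeAlgebra K (Fin g) →ₐ[K] B) (l : Fin g) :
    φ (formRelator (coeffForm (outerCoeffs M)) l) =
      ∑ j, wordEval (fun i => φ (FreeAlgebra.ι K i)) p (M l j) * φ (FreeAlgebra.ι K j) := by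
  have h1 : formRelator (coeffForm (outerCoeffs M)) l =
      wordEval (FreeAlgebra.ι K) (p + 1) fun F => outerCoeffs M (Fin.cons l F) := by
    rw [wordEval_apply, formRelator]
    refine Finset.sum_congr rfl fun F _ => ?_
    congr 1
    rw [← coeffForm_single (outerCoeffs M)]
    congr 1
    funext k
    refine Fin.cases ?_ (fun k => ?_) k <;> simp
  rw [h1, map_wordEval, wordEval_snoc]
  simp only [outerCoeffs_cons, Fin.snoc_last, Fin.init_snoc]

namespace IsRelationMatrix

variable (h : IsRelationMatrix y p m) {M : Fin g → Fin g → (Fin p → Fin g) → K}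
  (hM : ∀ i j, wordEval (fun j => (y j : A)) p (M i j) = m i j)

/-- The homomorphism from the algebra of the form to `A`. -/
def toAlgebra : FormAlgebra (coeffForm (outerCoeffs M)) →ₐ[K] A :=
  RingQuot.liftAlgHom K ⟨FreeAlgebra.lift K fun j => (y j : A), by
    rintro _ _ ⟨l⟩
    rw [map_zero, formRelator_coeffForm]
    simp only [FreeAlgebra.lift_ι_apply, hM]
    exact h.row_rel l⟩

lemma toAlgebra_x (l : Fin g) : h.toAlgebra hM (FormAlgebra.x _ l) = y l := by
  simp [toAlgebra, FormAlgebra.x]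

variable [GradedAlgebra 𝒜]

lemma map_component (hG : IsGrAlg 𝒜) (n : ℕ) :
    (FormAlgebra.component (coeffForm (outerCoeffs M)) n).map (h.toAlgebra hM).toLinearMap =
      𝒜 n := by
  rw [FormAlgebra.component, Submodule.map_pow, Submodule.map_span, ← Set.range_comp]
  have : ((h.toAlgebra hM).toLinearMap ∘ FormAlgebra.x _) = fun j => (y j : A) :=
    funext fun j => h.toAlgebra_x hM j
  rw [this, span_range_basis, ← hG.part_eq_pow]

lemma toAlgebra_mem (hG : IsGrAlg 𝒜) {n : ℕ} {t : FormAlgebra (coeffForm (outerCoeffs M))}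
    (ht : t ∈ FormAlgebra.component _ n) : h.toAlgebra hM t ∈ intPart 𝒜 n := by
  rw [intPart_natCast, ← h.map_component hM hG]
  exact Submodule.mem_map_of_mem ht

/-- Induction on the degree: write `t` with the generators on the right. Its coefficient vector is a
relation in `A`, hence a combination of the rows of `m`; by induction this lifts to the algebra of
the form, where the rows are relations by definition. -/
lemma eq_zero_of_mem_component (hG : IsGrAlg 𝒜) {n : ℕ}
    {t : FormAlgebra (coeffForm (outerCoeffs M))} (ht : t ∈ FormAlgebra.component _ n)
    (h0 : h.toAlgebra hM t = 0) : t = 0 := by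
  have hnon := hG.nontrivial
  set x := FormAlgebra.x (coeffForm (outerCoeffs M)) with hx
  have hxrel : ∀ i, ∑ j, wordEval x p (M i j) * x j = 0 := fun i => by
    have := RingQuot.mkAlgHom_rel K (FormRel.relator (w := coeffForm (outerCoeffs M)) i)
    rw [formRelator_coeffForm, map_zero] at this
    exact this
  induction n generalizing t with
  | zero =>
    rw [FormAlgebra.component, pow_zero] at ht
    obtain ⟨c, rfl⟩ := Submodule.mem_one.1 ht
    rw [AlgHom.commutes, map_eq_zero_iff _ (algebraMap K A).injective] at h0
    rw [h0, map_zero]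
  | succ n ih =>
    rw [FormAlgebra.component, pow_succ] at ht
    obtain ⟨s, hs, rfl⟩ := exists_sum_mul_of_mem_mul_span _ ht
    simp only [map_sum, map_mul, toAlgebra_x] at h0
    obtain ⟨b, hb, hbm⟩ := h.exists_coeffs h0 fun j => h.toAlgebra_mem hM hG (hs j)
    rcases lt_or_ge n p with hn | hn
    · refine Finset.sum_eq_zero fun j _ => ?_
      rw [ih (hs j), zero_mul]
      rw [hbm]
      refine Finset.sum_eq_zero fun i _ => ?_
      have := hb i
      rw [intPart_of_neg 𝒜 (by omega), Submodule.mem_bot] at this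
      rw [this, zero_mul]
    · have hb' : ∀ i, ∃ b' ∈ FormAlgebra.component (coeffForm (outerCoeffs M)) (n - p),
          h.toAlgebra hM b' = b i := fun i => by
        have := hb i
        rw [← Nat.cast_sub hn, intPart_natCast, ← h.map_component hM hG] at this
        exact this
      choose b' hb'mem hb' using hb'
      have hent : ∀ i j, h.toAlgebra hM (wordEval x p (M i j)) = m i j := fun i j => by
        rw [map_wordEval]
        simp only [hx, toAlgebra_x, hM]
      have hs0 : ∀ j, s j = ∑ i, b' i * wordEval x p (M i j) := fun j => by
        rw [← sub_eq_zero]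
        refine ih (Submodule.sub_mem _ (hs j) (Submodule.sum_mem _ fun i _ => ?_)) ?_
        · have h1 : wordEval x p (M i j) ∈
              FormAlgebra.component (coeffForm (outerCoeffs M)) p := by
            rw [FormAlgebra.component, ← hx, ← range_wordEval]
            exact LinearMap.mem_range_self _ _
          have h2 := Submodule.mul_mem_mul (hb'mem i) h1
          rwa [FormAlgebra.component, FormAlgebra.component, ← pow_add, Nat.sub_add_cancel hn] at h2
        · rw [map_sub, map_sum, hbm, sub_eq_zero]
          simp only [map_mul, hb', hent]
      simp only [hs0, Finset.sum_mul, mul_assoc]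
      rw [Finset.sum_comm]
      refine Finset.sum_eq_zero fun i _ => ?_
      rw [← Finset.mul_sum, ← hx, hxrel, mul_zero]

lemma toAlgebra_bijective (hG : IsGrAlg 𝒜) : Function.Bijective (h.toAlgebra hM) := by
  constructor
  · rw [injective_iff_map_eq_zero]
    intro t ht
    have htop : t ∈ ⨆ n, FormAlgebra.component (coeffForm (outerCoeffs M)) n := by
      rw [iSup_component]
      trivial
    obtain ⟨f, hf, rfl⟩ := (Submodule.mem_iSup_iff_exists_finsupp _ _).1 htop
    have hf0 : ∀ n, f n = 0 := fun n => by
      refine h.eq_zero_of_mem_component hM hG (hf n) ?_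
      have h1 := congrArg (intProj 𝒜 n) ht
      rw [map_zero, Finsupp.sum, map_sum, map_sum] at h1
      by_cases hn : n ∈ f.support
      · rw [Finset.sum_eq_single_of_mem n hn fun k _ hk =>
          intProj_of_mem_ne (h.toAlgebra_mem hM hG (hf k)) (by exact_mod_cast hk),
          intProj_of_mem (h.toAlgebra_mem hM hG (hf n))] at h1
        exact h1
      · rw [Finsupp.notMem_support_iff.1 hn, map_zero]
    simp [Finsupp.sum, hf0]
  · classical
    intro a
    change a ∈ LinearMap.range (h.toAlgebra hM).toLinearMap
    rw [← DirectSum.sum_support_decompose 𝒜 a]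
    refine Submodule.sum_mem _ fun n _ => ?_
    have hle : 𝒜 n ≤ LinearMap.range (h.toAlgebra hM).toLinearMap :=
      (h.map_component hM hG n).ge.trans LinearMap.map_le_range
    exact hle (SetLike.coe_mem _)

end IsRelationMatrix

end FormAlgebraIso
end

theorem theorem3p1 {K : Type v} [Field K] {A : Type u} [Ring A] [Algebra K A]
    (𝒜 : ℕ → Submodule K A) [GradedAlgebra 𝒜] (hA : IsRegularAlgebra 𝒜 3) :
    ∃ N : ℕ, 2 ≤ N ∧ ∃ g : ℕ, 2 ≤ g ∧
      ∃ w : MultilinearMap K (fun _ : Fin (N + 1) => Fin g → K) K,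
        IsThreeRegular w ∧
          ∃ e : FormAlgebra w ≃ₐ[K] A,
            ∀ n : ℕ, (FormAlgebra.component w n).map e.toLinearMap = 𝒜 n := by
  have := hA.grAlg.finite_degree_one
  let y := Module.finBasis K (𝒜 1)
  obtain ⟨p, hp, m, h⟩ := hA.exists_relation_matrix y
  obtain ⟨M, hM⟩ := h.exists_entry_coeffs hA.grAlg
  -- The relations have degree `p + 1`, one more than the entries of `m`.
  exact ⟨p + 1, by omega, _, h.two_le hA, coeffForm (outerCoeffs M), h.isThreeRegular hM hA,
    AlgEquiv.ofBijective (h.toAlgebra hM) (h.toAlgebra_bijective hM hA.grAlg),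
    h.map_component hM hA.grAlg⟩
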